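/- **Setting.** Let $f:\mathbb R^n\to\mathbb R^n$ be continuously differentiable, $B\in\mathbb R^{n\times m}$, $\varepsilon>0$, and $\mathcal X=[\underline x,\overline x]\subset\mathbb R^n$ a box with $\underline x\le\overline x$. A feedforward network is a map $z_0=x$, $\xi_{k+1}=W_kz_k+b_k$, $z_{k+1}=\sigma(\xi_{k+1})$, with output $\xi_{L+1}$, where $\sigma$ acts entrywise. Let $u:\mathbb R^n\to\mathbb R^m$ and $N:\mathbb R^n\to\mathbb R^{n\times n}$ (output reshaped to a matrix) be feedforward networks whose activations are monotone increasing and twice continuously differentiable with $\sigma''\ge 0$. Put $f_{CL}(x)=f(x)+Bu(x)$, $M(x)=N(x)^\top N(x)+\varepsilon I$, and $$\mathcal A(x)=M(x)J_{f_{CL}}(x)+J_{f_{CL}}(x)^\top M(x)+\dot M_{f_{CL}}(x),\qquad [\dot M_g(x)]_{ij}=\nabla M_{ij}(x)^\top g(x).$$ Let $[\underline f,\overline f]$ and $[\underline{J_f},\overline{J_f}]$ be any entrywise bounds on $f$ and $J_f$ that are valid on $\mathcal X$. **Bounds.** For interval matrices let $\mathrm{IMM}([\underline A,\overline A],[\underline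 B,\overline B])$ be the interval matrix whose $(i,j)$ entry is the sum over $p$ of the intervals $[\min,\max]$ of the four products $\underline a_{ip}\underline b_{pj},\underline a_{ip}\overline b_{pj},\overline a_{ip}\underline b_{pj},\overline a_{ip}\overline b_{pj}$. With $[W]^+=\max(W,0)$ entrywise and $[W]^-=W-[W]^+$, interval bound propagation over $\mathcal X$ sets $\underline z_0=\underline x$, $\overline z_0=\overline x$ and $$\underline\xi_{k+1}=[W_k]^+\underline z_k+[W_k]^-\overline z_k+b_k,\quad \overline\xi_{k+1}=[W_k]^+\overline z_k+[W_k]^-\underline z_k+b_k,\quad \underline z_{k+1}=\sigma(\underline\xi_{k+1}),\quad \overline z_{k+1}=\sigma(\overline\xi_{k+1}),$$ and bounds the output by $[\underline\xi_{L+1},\overline\xi_{L+1}]$. The Jacobian of the network is bounded by starting from $[I,I]$ and multiplying on the left, by $\mathrm{IMM}$, in turn by $[W_0,W_0]$, $[\mathrm{diag}\,\sigma'(\underline\xi_1),\mathrm{diag}\,\sigma'(\overline\xi_1)]$, $[W_1,W_1]$, …, $[\mathrm{diag}\,\sigma'(\underline\xi_L),\mathrm{diag}\,\sigma'(\overline\xi_L)]$,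 $[W_L,W_L]$. Apply this to $N$, and let $N_i$ denote the $i$-th column of $N$. Bound - $Bu$ and $BJ_u$ either by $\mathrm{IMM}$ of $[B,B]$ with the bounds on $u$ and $J_u$, or by running the two procedures on the network $Bu$ (output weight $BW_L$, output bias $Bb_L$); - $M=N^\top N+\varepsilon I$ by $\mathrm{IMM}$ of the bounds on $N^\top$ and $N$, plus $\varepsilon I$; - $\nabla M_{ij}=J_{N_i}^\top N_j+J_{N_j}^\top N_i$ by the sum of two $\mathrm{IMM}$s; - $[\dot M_f]_{ij}$ and $[\dot M_{Bu}]_{ij}$ by $\mathrm{IMM}$ of the bounds on $\nabla M_{ij}^\top$ with those on $f$ and on $Bu$; - $MJ_f\in[L_f,U_f]$ and $MBJ_u\in[L_u,U_u]$ by $\mathrm{IMM}$. Let $[\underline{\mathcal A},\overline{\mathcal A}]$ have lower end $L_f+L_f^\top+\underline{\dot M}_f+L_u+L_u^\top+\underline{\dot M}_{Bu}$ and upper end $U_f+U_f^\top+\overline{\dot M}_f+U_u+U_u^\top+\overline{\dot M}_{Bu}$, and let $G$ be the (symmetric) matrix with $G_{ii}=\overline{\mathcal A}_{ii}$ and $G_{ij}=\max\{\overline{\mathcal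 A}_{ij},-\underline{\mathcal A}_{ij}\}$ for $i\ne j$. **Claim.** If $\lambda_{\max}(G)\le 0$, then $\mathcal A(x)\preceq 0$ for all $x\in\mathcal X$. In particular, the closed loop $\dot x=f_{CL}(x)$ is contracting on $\mathcal X$ (with rate $c=0$) with respect to the metric $M$, in the following sense. 1. $M$ is continuously differentiable and symmetric, there are $a_0,a_1>0$ with $a_0I\preceq M(x)\preceq a_1I$ on $\mathcal X$, and $MJ_{f_{CL}}+J_{f_{CL}}^\top M+\dot M_{f_{CL}}\preceq -2cM$ on $\mathcal X$. 2. For $S\subseteq\mathbb R^n$ let $d_S(p,q)$ be the infimum of the $M$-lengths of the $C^1$ curves in $S$ from $p$ to $q$ ($\infty$ if there are none). If $T\ge 0$, $V\subseteq\mathcal X$, and from every point of $V$ there starts a solution that exists and stays in $\mathcal X$ during $[0,T]$, then any two solutions $x,y$ on $[0,T]$ that start in $V$ satisfy $d_{\mathcal X}(x(T),y(T))\le e^{-cT}d_V(x(0),y(0))$. In particular, if $\mathcal X$ is forward invariant, then $d_{\mathcal X}(x(T),y(T))\le e^{-cT}d_{\mathcal X}(x(0),y(0))$. -/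

import Mathlib

open scoped Matrix ENNReal

noncomputable section

namespace NeuralContraction

/-! Interval vectors and interval matrices -/

/-- Entrywise lower and upper bounds `[lo, hi]` for a vector. -/
structure IVec (ι : Type) where
  lo : ι → ℝ
  hi : ι → ℝ

/-- Entrywise lower and upper bounds `[lo, hi]` for a matrix. -/
structure IMat (ι κ : Type) where
  lo : Matrix ι κ ℝ
  hi : Matrix ι κ ℝ

/-- `v ∈ [lo, hi]` entrywise. -/
def IVec.Contains {ι : Type} (b : IVec ι) (v : ι → ℝ) : Prop :=
  ∀ i, b.lo i ≤ v i ∧ v i ≤ b.hi i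

/-- `A ∈ [lo, hi]` entrywise. -/
def IMat.Contains {ι κ : Type} (b : IMat ι κ) (A : Matrix ι κ ℝ) : Prop :=
  ∀ i j, b.lo i j ≤ A i j ∧ A i j ≤ b.hi i j

/-- The degenerate interval matrix `[A, A]`. -/
def IMat.point {ι κ : Type} (A : Matrix ι κ ℝ) : IMat ι κ := ⟨A, A⟩

/-- Sum of interval matrices. -/
def IMat.add {ι κ : Type} (a b : IMat ι κ) : IMat ι κ := ⟨a.lo + b.lo, a.hi + b.hi⟩

/-- Transpose of an interval matrix. -/
def IMat.transpose {ι κ : Type} (a : IMat ι κ) : IMat κ ι := ⟨a.loᵀ, a.hiᵀ⟩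

/-- An interval vector as an interval column. -/
def IVec.col {ι : Type} (b : IVec ι) : IMat ι Unit :=
  ⟨Matrix.of fun i _ => b.lo i, Matrix.of fun i _ => b.hi i⟩

/-- An interval column as an interval vector. -/
def IMat.toVec {ι : Type} (b : IMat ι Unit) : IVec ι :=
  ⟨fun i => b.lo i (), fun i => b.hi i ()⟩

/-- Interval matrix multiplication: the bounds on `A * B` for `A ∈ [a.lo, a.hi]` and
`B ∈ [b.lo, b.hi]` obtained by summing the bounds on the products of entries. -/
def IMM {ι κ μ : Type} [Fintype κ] (a : IMat ι κ) (b : IMat κ μ) : IMat ι μ where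
  lo := Matrix.of fun i j => ∑ p,
    min (min (a.lo i p * b.lo p j) (a.lo i p * b.hi p j))
      (min (a.hi i p * b.lo p j) (a.hi i p * b.hi p j))
  hi := Matrix.of fun i j => ∑ p,
    max (max (a.lo i p * b.lo p j) (a.lo i p * b.hi p j))
      (max (a.hi i p * b.lo p j) (a.hi i p * b.hi p j))

/-! Feedforward neural networks -/

/-- A feedforward network with input space `ℝⁿ` and output coordinates indexed by `ι`: finitely
many hidden layers `z ↦ σ (W z + b)` of arbitrary widths followed by an affine output layer. -/
inductive FFNN (ι : Type) : ℕ → Type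
  | output {n : ℕ} (W : Matrix ι (Fin n) ℝ) (b : ι → ℝ) : FFNN ι n
  | hidden {n k : ℕ} (W : Matrix (Fin k) (Fin n) ℝ) (b : Fin k → ℝ) (rest : FFNN ι k) : FFNN ι n

/-- The map computed by the network when the activation `σ` acts entrywise. -/
def FFNN.eval {ι : Type} (σ : ℝ → ℝ) : {n : ℕ} → FFNN ι n → (Fin n → ℝ) → ι → ℝ
  | _, .output W b, z => W *ᵥ z + b
  | _, .hidden W b rest, z => rest.eval σ (fun i => σ ((W *ᵥ z + b) i))

/-- The positive part `[W]⁺ = ReLU(W)`, entrywise. -/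
def matPos {ι κ : Type} (W : Matrix ι κ ℝ) : Matrix ι κ ℝ := W.map fun w => max w 0

/-- Pre-activation bounds of one layer:
`[W]⁺ lo + [W]⁻ hi + b` and `[W]⁺ hi + [W]⁻ lo + b`, where `[W]⁻ = W - [W]⁺`. -/
def affineBounds {ι κ : Type} [Fintype κ] (W : Matrix ι κ ℝ) (b : ι → ℝ) (z : IVec κ) :
    IVec ι where
  lo := matPos W *ᵥ z.lo + (W - matPos W) *ᵥ z.hi + b
  hi := matPos W *ᵥ z.hi + (W - matPos W) *ᵥ z.lo + b

/-- Post-activation bounds. -/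
def IVec.map {ι : Type} (σ : ℝ → ℝ) (ξ : IVec ι) : IVec ι :=
  ⟨fun i => σ (ξ.lo i), fun i => σ (ξ.hi i)⟩

/-- Interval bound propagation: bounds on the network output for inputs in `z`. -/
def FFNN.ibp {ι : Type} (σ : ℝ → ℝ) : {n : ℕ} → FFNN ι n → IVec (Fin n) → IVec ι
  | _, .output W b, z => affineBounds W b z
  | _, .hidden W b rest, z => rest.ibp σ ((affineBounds W b z).map σ)

/-- The interval matrix whose ends are `diag σ'(ξ.lo)` and `diag σ'(ξ.hi)`. -/
def activationJacBounds {ι : Type} [DecidableEq ι] (σ : ℝ → ℝ) (ξ : IVec ι) : IMat ι ι where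
  lo := Matrix.diagonal fun i => deriv σ (ξ.lo i)
  hi := Matrix.diagonal fun i => deriv σ (ξ.hi i)

/-- The running product of the interval Jacobian algorithm: `P` bounds the Jacobian of the layers
already processed and is multiplied on the left by the weights and by the interval diagonal
matrices, while `z` carries the bounds on the input of the current layer. -/
def FFNN.jacAux {ι : Type} (σ : ℝ → ℝ) {n₀ : ℕ} :
    {n : ℕ} → FFNN ι n → IVec (Fin n) → IMat (Fin n) (Fin n₀) → IMat ι (Fin n₀)
  | _, .output W _, _, P => IMM (.point W) P
  | _, .hidden W b rest, z, P =>
      rest.jacAux σ ((affineBounds W b z).map σ)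
        (IMM (activationJacBounds σ (affineBounds W b z)) (IMM (.point W) P))

/-- Bounds on the Jacobian of the network for inputs in `z`, starting from `P = [I, I]`. -/
def FFNN.jacBounds {ι : Type} (σ : ℝ → ℝ) {n : ℕ} (N : FFNN ι n) (z : IVec (Fin n)) :
    IMat ι (Fin n) :=
  N.jacAux σ z (.point 1)

/-- The network `x ↦ B N(x)` obtained by replacing the output weight `W` and the output bias `b`
by `B W` and `B b`. -/
def FFNN.elide {ι κ : Type} [Fintype ι] (B : Matrix κ ι ℝ) : {n : ℕ} → FFNN ι n → FFNN κ n
  | _, .output W b => .output (B * W) (B *ᵥ b)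
  | _, .hidden W b rest => .hidden W b (rest.elide B)

/-- Monotone, twice continuously differentiable activations with `σ'' ≥ 0`. -/
structure AdmissibleActivation (σ : ℝ → ℝ) : Prop where
  monotone : Monotone σ
  contDiff : ContDiff ℝ 2 σ
  deriv2_nonneg : ∀ t, 0 ≤ deriv (deriv σ) t

/-! The closed loop, the neural metric and the contraction matrix -/

/-- The Jacobian matrix of `F` at `x`. -/
def jac {n m : ℕ} (F : (Fin n → ℝ) → Fin m → ℝ) (x : Fin n → ℝ) : Matrix (Fin m) (Fin n) ℝ :=
  LinearMap.toMatrix' (fderiv ℝ F x : (Fin n → ℝ) →ₗ[ℝ] (Fin m → ℝ))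

/-- The Lie derivative of the matrix field `M` along `F`: its `(i, j)` entry at `x` is the
derivative of `M_ij` at `x` in the direction `F x`. -/
def lieDeriv {n : ℕ} (M : (Fin n → ℝ) → Matrix (Fin n) (Fin n) ℝ)
    (F : (Fin n → ℝ) → Fin n → ℝ) (x : Fin n → ℝ) : Matrix (Fin n) (Fin n) ℝ :=
  Matrix.of fun i j => fderiv ℝ (fun y => M y i j) x (F x)

/-- `M(x) J_F(x) + J_F(x)ᵀ M(x) + Ṁ_F(x)`. -/
def contractionMatrix {n : ℕ} (M : (Fin n → ℝ) → Matrix (Fin n) (Fin n) ℝ)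
    (F : (Fin n → ℝ) → Fin n → ℝ) (x : Fin n → ℝ) : Matrix (Fin n) (Fin n) ℝ :=
  M x * jac F x + (jac F x)ᵀ * M x + lieDeriv M F x

/-- The closed-loop vector field `f(x) + B u(x)`. -/
def closedLoop {n m : ℕ} (f : (Fin n → ℝ) → Fin n → ℝ) (B : Matrix (Fin n) (Fin m) ℝ)
    (u : (Fin n → ℝ) → Fin m → ℝ) (x : Fin n → ℝ) : Fin n → ℝ :=
  f x + B *ᵥ u x

/-- The output of `N` reshaped to a square matrix. -/
def netMatrix {n : ℕ} (σ : ℝ → ℝ) (N : FFNN (Fin n × Fin n) n) (x : Fin n → ℝ) :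
    Matrix (Fin n) (Fin n) ℝ :=
  Matrix.of fun i j => N.eval σ x (i, j)

/-- The neural metric `M(x) = N(x)ᵀ N(x) + ε I`. -/
def neuralMetric {n : ℕ} (σ : ℝ → ℝ) (N : FFNN (Fin n × Fin n) n) (ε : ℝ) (x : Fin n → ℝ) :
    Matrix (Fin n) (Fin n) ℝ :=
  (netMatrix σ N x)ᵀ * netMatrix σ N x + ε • (1 : Matrix (Fin n) (Fin n) ℝ)

/-! The matrix `G` -/

/-- Bounds on the matrix `N(x)` by interval bound propagation. -/
def netMatrixBounds {n : ℕ} (σ : ℝ → ℝ) (N : FFNN (Fin n × Fin n) n) (X : IVec (Fin n)) :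
    IMat (Fin n) (Fin n) where
  lo := Matrix.of fun i j => (N.ibp σ X).lo (i, j)
  hi := Matrix.of fun i j => (N.ibp σ X).hi (i, j)

/-- Bounds on `N_j(x)`, the `j`-th column of `N(x)`. -/
def netColBounds {n : ℕ} (σ : ℝ → ℝ) (N : FFNN (Fin n × Fin n) n) (X : IVec (Fin n))
    (j : Fin n) : IVec (Fin n) where
  lo := fun k => (netMatrixBounds σ N X).lo k j
  hi := fun k => (netMatrixBounds σ N X).hi k j

/-- Bounds on the Jacobian of `N_j`, the `j`-th column of `N`. -/
def netColJacBounds {n : ℕ} (σ : ℝ → ℝ) (N : FFNN (Fin n × Fin n) n) (X : IVec (Fin n))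
    (j : Fin n) : IMat (Fin n) (Fin n) where
  lo := Matrix.of fun k l => (N.jacBounds σ X).lo (k, j) l
  hi := Matrix.of fun k l => (N.jacBounds σ X).hi (k, j) l

/-- Bounds on `M(x) = N(x)ᵀ N(x) + ε I`. -/
def metricBounds {n : ℕ} (σ : ℝ → ℝ) (N : FFNN (Fin n × Fin n) n) (ε : ℝ) (X : IVec (Fin n)) :
    IMat (Fin n) (Fin n) :=
  (IMM (netMatrixBounds σ N X).transpose (netMatrixBounds σ N X)).add
    (.point (ε • (1 : Matrix (Fin n) (Fin n) ℝ)))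

/-- Bounds on the column `∇M_ij = J_{N_i}ᵀ N_j + J_{N_j}ᵀ N_i`. -/
def gradMetricBounds {n : ℕ} (σ : ℝ → ℝ) (N : FFNN (Fin n × Fin n) n) (X : IVec (Fin n))
    (i j : Fin n) : IMat (Fin n) Unit :=
  (IMM (netColJacBounds σ N X i).transpose (netColBounds σ N X j).col).add
    (IMM (netColJacBounds σ N X j).transpose (netColBounds σ N X i).col)

/-- Bounds on `Ṁ_g`, entry by entry, from bounds on `∇M_ij` and bounds `g` on a vector field. -/
def lieBounds {n : ℕ} (σ : ℝ → ℝ) (N : FFNN (Fin n × Fin n) n) (X : IVec (Fin n))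
    (g : IVec (Fin n)) : IMat (Fin n) (Fin n) where
  lo := Matrix.of fun i j => (IMM (gradMetricBounds σ N X i j).transpose g.col).lo () ()
  hi := Matrix.of fun i j => (IMM (gradMetricBounds σ N X i j).transpose g.col).hi () ()

/-- Bounds on one component `M J + Jᵀ M + Ṁ_g`, from bounds `g` on a vector field and bounds `J`
on its Jacobian. -/
def componentBounds {n : ℕ} (σ : ℝ → ℝ) (N : FFNN (Fin n × Fin n) n) (ε : ℝ) (X : IVec (Fin n))
    (g : IVec (Fin n)) (J : IMat (Fin n) (Fin n)) : IMat (Fin n) (Fin n) :=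
  ((IMM (metricBounds σ N ε X) J).add (IMM (metricBounds σ N ε X) J).transpose).add
    (lieBounds σ N X g)

/-- The two ways of bounding `B u(x)` and `B J_u(x)`: multiply the bounds on `u` and `J_u` by `B`
with interval matrix multiplication, or elide the output layer, that is, run the procedures on the
network `B u`. -/
inductive InputRule
  | multiply
  | elide

/-- Bounds on `B u(x)`. -/
def inputBounds {n m : ℕ} (r : InputRule) (σ : ℝ → ℝ) (B : Matrix (Fin n) (Fin m) ℝ)
    (u : FFNN (Fin m) n) (X : IVec (Fin n)) : IVec (Fin n) :=
  match r with
  | .multiply => (IMM (.point B) (u.ibp σ X).col).toVec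
  | .elide => (u.elide B).ibp σ X

/-- Bounds on `B J_u(x)`. -/
def inputJacBounds {n m : ℕ} (r : InputRule) (σ : ℝ → ℝ) (B : Matrix (Fin n) (Fin m) ℝ)
    (u : FFNN (Fin m) n) (X : IVec (Fin n)) : IMat (Fin n) (Fin n) :=
  match r with
  | .multiply => IMM (.point B) (u.jacBounds σ X)
  | .elide => (u.elide B).jacBounds σ X

/-- The bounds on the closed-loop contraction matrix over the box `X`, from bounds `fB` on `f` and
`JfB` on `J_f`: the sum of the bounds on the component of `f` and on that of `B u`. -/
def contractionBounds {n m : ℕ} (r : InputRule) (σu σN : ℝ → ℝ) (B : Matrix (Fin n) (Fin m) ℝ)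
    (u : FFNN (Fin m) n) (N : FFNN (Fin n × Fin n) n) (ε : ℝ) (X : IVec (Fin n))
    (fB : IVec (Fin n)) (JfB : IMat (Fin n) (Fin n)) : IMat (Fin n) (Fin n) :=
  (componentBounds σN N ε X fB JfB).add
    (componentBounds σN N ε X (inputBounds r σu B u X) (inputJacBounds r σu B u X))

/-- The constant matrix built from bounds `[a.lo, a.hi]`: the entry `max (a.hi i j) (-a.lo i j)`
off the diagonal and `a.hi i i` on the diagonal. -/
def majorant {n : ℕ} (a : IMat (Fin n) (Fin n)) : Matrix (Fin n) (Fin n) ℝ :=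
  Matrix.of fun i j => if i = j then a.hi i j else max (a.hi i j) (-a.lo i j)

/-- The largest eigenvalue of a symmetric real matrix. -/
def lambdaMax {n : ℕ} (A : Matrix (Fin n) (Fin n) ℝ) : ℝ := sSup (spectrum ℝ A)

/-! Contraction -/

/-- `M` satisfies, on the region `S`, the contraction inequality with rate `c` for `ẋ = F(x)`:
`M` is continuously differentiable and symmetric, it is uniformly positive definite and bounded
on `S`, and `M J_F + J_Fᵀ M + Ṁ_F ⪯ -2 c M` there. -/
structure IsContractionMetricOn {n : ℕ} (F : (Fin n → ℝ) → Fin n → ℝ)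
    (M : (Fin n → ℝ) → Matrix (Fin n) (Fin n) ℝ) (c : ℝ) (S : Set (Fin n → ℝ)) : Prop where
  contDiff : ∀ i j, ContDiff ℝ 1 fun x => M x i j
  symm : ∀ x, (M x).IsSymm
  bounds : ∃ a₀ a₁ : ℝ, 0 < a₀ ∧ 0 < a₁ ∧ ∀ x ∈ S,
    (M x - a₀ • (1 : Matrix (Fin n) (Fin n) ℝ)).PosSemidef ∧
    (a₁ • (1 : Matrix (Fin n) (Fin n) ℝ) - M x).PosSemidef
  inequality : ∀ x ∈ S, ((-2 * c) • M x - contractionMatrix M F x).PosSemidef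

/-- `γ : [0, 1] → S` is a continuously differentiable curve from `p` to `q`. -/
structure IsCurveIn {n : ℕ} (S : Set (Fin n → ℝ)) (p q : Fin n → ℝ) (γ : ℝ → Fin n → ℝ) :
    Prop where
  contDiffOn : ContDiffOn ℝ 1 γ (Set.Icc 0 1)
  mapsTo : Set.MapsTo γ (Set.Icc 0 1) S
  source : γ 0 = p
  target : γ 1 = q

/-- The length of `γ : [0, 1] → ℝⁿ` in the Riemannian metric `M`. -/
def curveLength {n : ℕ} (M : (Fin n → ℝ) → Matrix (Fin n) (Fin n) ℝ) (γ : ℝ → Fin n → ℝ) : ℝ :=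
  ∫ s in (0 : ℝ)..1, √(derivWithin γ (Set.Icc 0 1) s ⬝ᵥ
    (M (γ s) *ᵥ derivWithin γ (Set.Icc 0 1) s))

/-- The geodesic distance of the metric `M` within `S`: the infimum of the lengths of the
continuously differentiable curves in `S` from `p` to `q` (`∞` if there are none). -/
def geodesicDist {n : ℕ} (M : (Fin n → ℝ) → Matrix (Fin n) (Fin n) ℝ) (S : Set (Fin n → ℝ))
    (p q : Fin n → ℝ) : ℝ≥0∞ :=
  ⨅ (γ : ℝ → Fin n → ℝ) (_ : IsCurveIn S p q γ), ENNReal.ofReal (curveLength M γ)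

/-- `x` solves `ẋ = F(x)` on `[0, T]`. -/
def IsSolutionOn {n : ℕ} (F : (Fin n → ℝ) → Fin n → ℝ) (T : ℝ) (x : ℝ → Fin n → ℝ) : Prop :=
  ∀ t ∈ Set.Icc 0 T, HasDerivWithinAt x (F (x t)) (Set.Icc 0 T) t

/-- `ẋ = F(x)` contracts geodesic distances at rate `c` as long as the flow remains in `S`: if the
solutions that start in `V ⊆ S` stay in `S` during `[0, T]`, then any two of them satisfy
`d_S(x(T), y(T)) ≤ e^{-cT} d_V(x(0), y(0))`. A forward invariant `S` may be taken as `V`. -/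
def IsContractingOn {n : ℕ} (F : (Fin n → ℝ) → Fin n → ℝ)
    (M : (Fin n → ℝ) → Matrix (Fin n) (Fin n) ℝ) (c : ℝ) (S : Set (Fin n → ℝ)) : Prop :=
  ∀ T : ℝ, 0 ≤ T → ∀ V ⊆ S,
    (∀ p ∈ V, ∃ z, IsSolutionOn F T z ∧ z 0 = p ∧ Set.MapsTo z (Set.Icc 0 T) S) →
    ∀ x y : ℝ → Fin n → ℝ, IsSolutionOn F T x → IsSolutionOn F T y → x 0 ∈ V → y 0 ∈ V →
      geodesicDist M S (x T) (y T) ≤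
        ENNReal.ofReal (Real.exp (-c * T)) * geodesicDist M V (x 0) (y 0)

end NeuralContraction

end

noncomputable section

namespace NeuralContraction

/-! ### From interval bounds to negative semidefiniteness -/

section

/-! Soundness of the interval operations -/

/-! The first half is interval arithmetic. Every bound is a composition of sound operations, so the
contraction matrix lies entrywise in the computed interval (`contractionBounds_contains`); monotone
`σ` and `σ'` allow activations and their derivatives to be bounded at the interval ends. For
symmetric `A` in that interval, `xᵀAx ≤ |x|ᵀG|x| ≤ 0`, where `|x|` is taken entrywise and the last
inequality is `lambdaMax G ≤ 0` (`posSemidef_neg_of_abs_le`).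

The second half derives contraction of distances without differentiating the flow in its initial
value. For two nearby solutions put `w = y - x` and `E = wᵀM(x)w`. The derivative of `E` is the
quadratic form of the contraction matrix plus the linearization error of `F`, which is at most `2ηE`
when the solutions are close. Hence short chords contract at rate `c - η`
(`IsContractionMetricOn.exists_metricNorm_sub_le`).

A curve is then cut into short arcs. The division points are carried along the flow and their images
joined by segments, which stay in the convex set `S`. On small scales the metric is almost constant,
so chords and arcs compare up to factors `1 + η`; letting `η → 0` gives the estimate
(`IsContractionMetricOn.geodesicDist_le_mul_curveLength`). -/

theorem mul_mem_product_bounds {a al ah b bl bh : ℝ} (ha : al ≤ a ∧ a ≤ ah) (hb : bl ≤ b ∧ b ≤ bh) :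
    min (min (al * bl) (al * bh)) (min (ah * bl) (ah * bh)) ≤ a * b ∧
      a * b ≤ max (max (al * bl) (al * bh)) (max (ah * bl) (ah * bh)) := by
  -- A product is linear in each factor separately, so it is extremal at an end of each interval;
  -- the sign of the fixed factor decides which end.
  have right : ∀ c : ℝ, min (c * bl) (c * bh) ≤ c * b ∧ c * b ≤ max (c * bl) (c * bh) := by
    intro c
    rcases le_total 0 c with hc | hc
    · exact ⟨min_le_of_left_le (mul_le_mul_of_nonneg_left hb.1 hc),
        le_max_of_le_right (mul_le_mul_of_nonneg_left hb.2 hc)⟩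
    · exact ⟨min_le_of_right_le (mul_le_mul_of_nonpos_left hb.2 hc),
        le_max_of_le_left (mul_le_mul_of_nonpos_left hb.1 hc)⟩
  have left : min (al * b) (ah * b) ≤ a * b ∧ a * b ≤ max (al * b) (ah * b) := by
    rcases le_total 0 b with hc | hc
    · exact ⟨min_le_of_left_le (mul_le_mul_of_nonneg_right ha.1 hc),
        le_max_of_le_right (mul_le_mul_of_nonneg_right ha.2 hc)⟩
    · exact ⟨min_le_of_right_le (mul_le_mul_of_nonpos_right ha.2 hc),
        le_max_of_le_left (mul_le_mul_of_nonpos_right ha.1 hc)⟩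
  exact ⟨(min_le_min (right al).1 (right ah).1).trans left.1,
    left.2.trans (max_le_max (right al).2 (right ah).2)⟩

variable {ι κ μ : Type}

theorem IMM_contains [Fintype κ] {a : IMat ι κ} {b : IMat κ μ} {A : Matrix ι κ ℝ}
    {B : Matrix κ μ ℝ} (hA : a.Contains A) (hB : b.Contains B) : (IMM a b).Contains (A * B) :=
  fun i j => ⟨Finset.sum_le_sum fun p _ => (mul_mem_product_bounds (hA i p) (hB p j)).1,
    Finset.sum_le_sum fun p _ => (mul_mem_product_bounds (hA i p) (hB p j)).2⟩

theorem IMat.contains_point (A : Matrix ι κ ℝ) : (IMat.point A).Contains A :=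
  fun _ _ => ⟨le_rfl, le_rfl⟩

theorem IMat.Contains.add {a b : IMat ι κ} {A B : Matrix ι κ ℝ} (hA : a.Contains A)
    (hB : b.Contains B) : (a.add b).Contains (A + B) :=
  fun i j => ⟨add_le_add (hA i j).1 (hB i j).1, add_le_add (hA i j).2 (hB i j).2⟩

theorem IMat.Contains.transpose {a : IMat ι κ} {A : Matrix ι κ ℝ} (hA : a.Contains A) :
    a.transpose.Contains Aᵀ :=
  fun i j => hA j i

theorem IVec.Contains.col {b : IVec ι} {v : ι → ℝ} (hv : b.Contains v) :
    b.col.Contains (Matrix.of fun i (_ : Unit) => v i) :=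
  fun i _ => hv i

theorem affineBounds_contains [Fintype κ] (W : Matrix ι κ ℝ) (b : ι → ℝ) {z : IVec κ}
    {v : κ → ℝ} (hv : z.Contains v) : (affineBounds W b z).Contains (W *ᵥ v + b) := by
  intro i
  have split : (W *ᵥ v) i = (matPos W *ᵥ v + (W - matPos W) *ᵥ v) i := by
    rw [← Matrix.add_mulVec, add_sub_cancel]
  have hp : ∀ j, 0 ≤ matPos W i j := fun j => le_max_right _ _
  have hn : ∀ j, (W - matPos W) i j ≤ 0 := fun j => sub_nonpos.2 (le_max_left _ _)
  simp only [affineBounds, Pi.add_apply, split]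
  refine ⟨add_le_add_left (add_le_add ?_ ?_) _, add_le_add_left (add_le_add ?_ ?_) _⟩ <;>
    refine Finset.sum_le_sum fun j _ => ?_
  · exact mul_le_mul_of_nonneg_left (hv j).1 (hp j)
  · exact mul_le_mul_of_nonpos_left (hv j).2 (hn j)
  · exact mul_le_mul_of_nonneg_left (hv j).2 (hp j)
  · exact mul_le_mul_of_nonpos_left (hv j).1 (hn j)

theorem IVec.Contains.map {σ : ℝ → ℝ} (hσ : Monotone σ) {ξ : IVec ι} {v : ι → ℝ}
    (hv : ξ.Contains v) : (ξ.map σ).Contains fun i => σ (v i) :=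
  fun i => ⟨hσ (hv i).1, hσ (hv i).2⟩

theorem activationJacBounds_contains [DecidableEq ι] {σ : ℝ → ℝ} (hσ : Monotone (deriv σ))
    {ξ : IVec ι} {v : ι → ℝ} (hv : ξ.Contains v) :
    (activationJacBounds σ ξ).Contains (Matrix.diagonal fun i => deriv σ (v i)) := by
  intro i j
  by_cases h : i = j
  · subst h
    simpa [activationJacBounds] using ⟨hσ (hv i).1, hσ (hv i).2⟩
  · simp [activationJacBounds, h]

theorem AdmissibleActivation.differentiable {σ : ℝ → ℝ} (hσ : AdmissibleActivation σ) :
    Differentiable ℝ σ :=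
  hσ.contDiff.differentiable (by norm_num)

/-- This is the role of `σ'' ≥ 0`: evaluating `σ'` at the ends of a pre-activation interval bounds
it throughout. -/
theorem AdmissibleActivation.monotone_deriv {σ : ℝ → ℝ} (hσ : AdmissibleActivation σ) :
    Monotone (deriv σ) := by
  have h : ContDiff ℝ 1 (deriv σ) := by
    have := hσ.contDiff
    rw [show (2 : WithTop ℕ∞) = 1 + 1 by norm_num, contDiff_succ_iff_deriv] at this
    exact this.2.2
  exact monotone_of_deriv_nonneg (h.differentiable (by norm_num)) hσ.deriv2_nonneg

/-! Networks: derivative, interval bounds, and elision of the output layer -/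

theorem FFNN.ibp_contains {σ : ℝ → ℝ} (hσ : Monotone σ) {n : ℕ} (N : FFNN ι n)
    {z : IVec (Fin n)} {v : Fin n → ℝ} (hv : z.Contains v) :
    (N.ibp σ z).Contains (N.eval σ v) := by
  induction N with
  | output W b => exact affineBounds_contains W b hv
  | hidden W b rest ih => exact ih ((affineBounds_contains W b hv).map hσ)

/-- The Jacobian matrix of a network, by the chain rule. -/
def FFNN.jacMat (σ : ℝ → ℝ) : {n : ℕ} → FFNN ι n → (Fin n → ℝ) → Matrix ι (Fin n) ℝ
  | _, .output W _, _ => W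
  | _, .hidden W b rest, z =>
      rest.jacMat σ (fun i => σ ((W *ᵥ z + b) i)) *
        (Matrix.diagonal (fun i => deriv σ ((W *ᵥ z + b) i)) * W)

/-- The induction needs an arbitrary accumulated factor `A` in `P`, since the algorithm multiplies
from the input side. Reassociation is applied only to the real matrices; the interval products keep
the order of the algorithm. -/
theorem FFNN.jacAux_contains {σ : ℝ → ℝ} (hσ : AdmissibleActivation σ) {n₀ n : ℕ} (N : FFNN ι n)
    {z : IVec (Fin n)} {v : Fin n → ℝ} (hv : z.Contains v) {P : IMat (Fin n) (Fin n₀)}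
    {A : Matrix (Fin n) (Fin n₀) ℝ} (hA : P.Contains A) :
    (N.jacAux σ z P).Contains (N.jacMat σ v * A) := by
  induction N with
  | output W b => exact IMM_contains (IMat.contains_point W) hA
  | hidden W b rest ih =>
    have hξ := affineBounds_contains W b hv
    have := ih (hξ.map hσ.monotone)
      (IMM_contains (activationJacBounds_contains hσ.monotone_deriv hξ)
        (IMM_contains (IMat.contains_point W) hA))
    simpa only [FFNN.jacAux, FFNN.jacMat, Matrix.mul_assoc] using this

theorem FFNN.jacBounds_contains {σ : ℝ → ℝ} (hσ : AdmissibleActivation σ) {n : ℕ} (N : FFNN ι n)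
    {z : IVec (Fin n)} {v : Fin n → ℝ} (hv : z.Contains v) :
    (N.jacBounds σ z).Contains (N.jacMat σ v) := by
  simpa [FFNN.jacBounds] using
    N.jacAux_contains hσ hv (IMat.contains_point (1 : Matrix (Fin n) (Fin n) ℝ))

theorem hasFDerivAt_mulVec_add [Fintype ι] [Fintype κ] (W : Matrix ι κ ℝ) (b : ι → ℝ)
    (v : κ → ℝ) :
    HasFDerivAt (fun v => W *ᵥ v + b) (LinearMap.toContinuousLinearMap W.mulVecLin) v :=
  ((LinearMap.toContinuousLinearMap W.mulVecLin).hasFDerivAt (x := v)).add_const b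

theorem FFNN.hasFDerivAt_eval [Fintype ι] {σ : ℝ → ℝ} (hσ : Differentiable ℝ σ) {n : ℕ}
    (N : FFNN ι n) (v : Fin n → ℝ) :
    HasFDerivAt (N.eval σ) (LinearMap.toContinuousLinearMap (N.jacMat σ v).mulVecLin) v := by
  induction N with
  | output W b => exact hasFDerivAt_mulVec_add W b v
  | hidden W b rest ih =>
    have hact : HasFDerivAt (fun v i => σ ((W *ᵥ v + b) i))
        (LinearMap.toContinuousLinearMap
          (Matrix.diagonal (fun i => deriv σ ((W *ᵥ v + b) i)) * W).mulVecLin) v := by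
      rw [hasFDerivAt_pi']
      intro i
      have h := (hσ ((W *ᵥ v + b) i)).hasDerivAt.comp_hasFDerivAt v
        (hasFDerivAt_pi'.1 (hasFDerivAt_mulVec_add W b v) i)
      refine h.congr_fderiv ?_
      ext w
      simp [Matrix.mulVec, dotProduct, Finset.mul_sum, mul_assoc]
    refine ((ih _).comp v hact).congr_fderiv ?_
    ext w : 1
    simp [FFNN.jacMat, Matrix.mulVec_mulVec]

theorem FFNN.contDiff_eval [Fintype ι] {σ : ℝ → ℝ} {k : WithTop ℕ∞} (hσ : ContDiff ℝ k σ) {n : ℕ}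
    (N : FFNN ι n) : ContDiff ℝ k (N.eval σ) := by
  have affine : ∀ {ι : Type} [Fintype ι] {n : ℕ} (W : Matrix ι (Fin n) ℝ) (b : ι → ℝ),
      ContDiff ℝ k fun v => W *ᵥ v + b := fun W b =>
    (LinearMap.toContinuousLinearMap W.mulVecLin).contDiff.add contDiff_const
  induction N with
  | output W b => exact affine W b
  | hidden W b rest ih =>
    exact ih.comp (contDiff_pi.2 fun i => hσ.comp (contDiff_pi.1 (affine W b) i))

theorem FFNN.eval_elide [Fintype ι] (B : Matrix κ ι ℝ) (σ : ℝ → ℝ) {n : ℕ} (N : FFNN ι n)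
    (v : Fin n → ℝ) : (N.elide B).eval σ v = B *ᵥ N.eval σ v := by
  induction N with
  | output W b => simp [FFNN.elide, FFNN.eval, Matrix.mulVec_add, Matrix.mulVec_mulVec]
  | hidden W b rest ih => exact ih _

theorem FFNN.jacMat_elide [Fintype ι] (B : Matrix κ ι ℝ) (σ : ℝ → ℝ) {n : ℕ} (N : FFNN ι n)
    (v : Fin n → ℝ) : (N.elide B).jacMat σ v = B * N.jacMat σ v := by
  induction N with
  | output W b => rfl
  | hidden W b rest ih => simp only [FFNN.elide, FFNN.jacMat, ih, Matrix.mul_assoc]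

theorem FFNN.jac_eval {σ : ℝ → ℝ} (hσ : Differentiable ℝ σ) {n m : ℕ}
    (N : FFNN (Fin m) n) (v : Fin n → ℝ) : jac (N.eval σ) v = N.jacMat σ v := by
  rw [jac, (N.hasFDerivAt_eval hσ v).fderiv]
  exact LinearMap.toMatrix'_toLin' _

variable {n m : ℕ}

theorem inputBounds_contains {σ : ℝ → ℝ} (hσ : Monotone σ) (r : InputRule)
    (B : Matrix (Fin n) (Fin m) ℝ) (u : FFNN (Fin m) n) {X : IVec (Fin n)} {v : Fin n → ℝ}
    (hv : X.Contains v) : (inputBounds r σ B u X).Contains (B *ᵥ u.eval σ v) := by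
  cases r with
  | multiply => exact fun i =>
      IMM_contains (IMat.contains_point B) (u.ibp_contains hσ hv).col i ()
  | elide =>
    rw [← FFNN.eval_elide]
    exact (u.elide B).ibp_contains hσ hv

theorem inputJacBounds_contains {σ : ℝ → ℝ} (hσ : AdmissibleActivation σ) (r : InputRule)
    (B : Matrix (Fin n) (Fin m) ℝ) (u : FFNN (Fin m) n) {X : IVec (Fin n)} {v : Fin n → ℝ}
    (hv : X.Contains v) : (inputJacBounds r σ B u X).Contains (B * u.jacMat σ v) := by
  cases r with
  | multiply => exact IMM_contains (IMat.contains_point B) (u.jacBounds_contains hσ hv)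
  | elide =>
    rw [← FFNN.jacMat_elide]
    exact (u.elide B).jacBounds_contains hσ hv

/-! The neural metric and the contraction matrix -/

theorem netMatrixBounds_contains {σ : ℝ → ℝ} (hσ : Monotone σ) (N : FFNN (Fin n × Fin n) n)
    {X : IVec (Fin n)} {v : Fin n → ℝ} (hv : X.Contains v) :
    (netMatrixBounds σ N X).Contains (netMatrix σ N v) :=
  fun i j => N.ibp_contains hσ hv (i, j)

theorem neuralMetric_isSymm (σ : ℝ → ℝ) (N : FFNN (Fin n × Fin n) n) (ε : ℝ) (x : Fin n → ℝ) :
    (neuralMetric σ N ε x).IsSymm := by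
  simp [Matrix.IsSymm, neuralMetric]

theorem neuralMetric_apply (σ : ℝ → ℝ) (N : FFNN (Fin n × Fin n) n) (ε : ℝ) (x : Fin n → ℝ)
    (i j : Fin n) : neuralMetric σ N ε x i j =
      ∑ k, N.eval σ x (k, i) * N.eval σ x (k, j) + ε * (1 : Matrix (Fin n) (Fin n) ℝ) i j := by
  simp [neuralMetric, netMatrix, Matrix.mul_apply]

theorem contDiff_neuralMetric {σ : ℝ → ℝ} {k : WithTop ℕ∞} (hσ : ContDiff ℝ k σ)
    (N : FFNN (Fin n × Fin n) n) (ε : ℝ) (i j : Fin n) :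
    ContDiff ℝ k fun x => neuralMetric σ N ε x i j := by
  have h := contDiff_pi.1 (N.contDiff_eval hσ)
  simp only [neuralMetric_apply]
  exact (ContDiff.sum fun k _ => (h _).mul (h _)).add contDiff_const

theorem fderiv_neuralMetric {σ : ℝ → ℝ} (hσ : Differentiable ℝ σ) (N : FFNN (Fin n × Fin n) n)
    (ε : ℝ) (x g : Fin n → ℝ) (i j : Fin n) :
    fderiv ℝ (fun y => neuralMetric σ N ε y i j) x g =
      ∑ k, (N.eval σ x (k, i) * (N.jacMat σ x *ᵥ g) (k, j) +
        N.eval σ x (k, j) * (N.jacMat σ x *ᵥ g) (k, i)) := by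
  have h := hasFDerivAt_pi'.1 (N.hasFDerivAt_eval hσ x)
  simp only [neuralMetric_apply]
  have := (HasFDerivAt.fun_sum (u := Finset.univ)
    fun k _ => (h (k, i)).fun_mul (h (k, j))).add_const (ε * (1 : Matrix (Fin n) (Fin n) ℝ) i j)
  rw [this.fderiv]
  simp

theorem metricBounds_contains {σ : ℝ → ℝ} (hσ : Monotone σ) (N : FFNN (Fin n × Fin n) n) (ε : ℝ)
    {X : IVec (Fin n)} {v : Fin n → ℝ} (hv : X.Contains v) :
    (metricBounds σ N ε X).Contains (neuralMetric σ N ε v) :=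
  have h := netMatrixBounds_contains hσ N hv
  (IMM_contains h.transpose h).add (IMat.contains_point _)

theorem gradMetricBounds_contains {σ : ℝ → ℝ} (hσ : AdmissibleActivation σ)
    (N : FFNN (Fin n × Fin n) n) {X : IVec (Fin n)} {v : Fin n → ℝ} (hv : X.Contains v)
    (i j : Fin n) : (gradMetricBounds σ N X i j).Contains (Matrix.of fun l (_ : Unit) =>
      ∑ k, N.jacMat σ v (k, i) l * N.eval σ v (k, j) +
        ∑ k, N.jacMat σ v (k, j) l * N.eval σ v (k, i)) := by
  have hJ : ∀ i, (netColJacBounds σ N X i).Contains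
      (Matrix.of fun k l => N.jacMat σ v (k, i) l) :=
    fun i k l => N.jacBounds_contains hσ hv (k, i) l
  have hN : ∀ j, (netColBounds σ N X j).Contains fun k => N.eval σ v (k, j) :=
    fun j k => N.ibp_contains hσ.monotone hv (k, j)
  exact (IMM_contains (hJ i).transpose (hN j).col).add (IMM_contains (hJ j).transpose (hN i).col)

theorem lieBounds_contains {σ : ℝ → ℝ} (hσ : AdmissibleActivation σ)
    (N : FFNN (Fin n × Fin n) n) (ε : ℝ) {X : IVec (Fin n)} {v : Fin n → ℝ} (hv : X.Contains v)
    {gB : IVec (Fin n)} {g : Fin n → ℝ} (hg : gB.Contains g) :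
    (lieBounds σ N X gB).Contains
      (Matrix.of fun i j => fderiv ℝ (fun y => neuralMetric σ N ε y i j) v g) := by
  intro i j
  have h := IMM_contains (gradMetricBounds_contains hσ N hv i j).transpose hg.col () ()
  have e : fderiv ℝ (fun y => neuralMetric σ N ε y i j) v g =
      ∑ l, (∑ k, N.jacMat σ v (k, i) l * N.eval σ v (k, j) +
        ∑ k, N.jacMat σ v (k, j) l * N.eval σ v (k, i)) * g l := by
    simp only [fderiv_neuralMetric hσ.differentiable, Matrix.mulVec, dotProduct, Finset.mul_sum,
      add_mul, Finset.sum_mul, Finset.sum_add_distrib]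
    -- The product rule lists its two terms in the opposite order to `gradMetricBounds` and sums
    -- over the row index outermost; both are exchanged.
    rw [add_comm, Finset.sum_comm, Finset.sum_comm (s := Finset.univ)
      (f := fun x i_1 => N.eval σ v (x, i) * (N.jacMat σ v (x, j) i_1 * g i_1))]
    congr 1 <;> exact Finset.sum_congr rfl fun _ _ => Finset.sum_congr rfl fun _ _ => by ring
  rw [Matrix.of_apply, e]
  exact h

theorem componentBounds_contains {σ : ℝ → ℝ} (hσ : AdmissibleActivation σ)
    (N : FFNN (Fin n × Fin n) n) (ε : ℝ) {X : IVec (Fin n)} {v : Fin n → ℝ} (hv : X.Contains v)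
    {gB : IVec (Fin n)} {g : Fin n → ℝ} (hg : gB.Contains g)
    {JB : IMat (Fin n) (Fin n)} {J : Matrix (Fin n) (Fin n) ℝ} (hJ : JB.Contains J) :
    (componentBounds σ N ε X gB JB).Contains
      (neuralMetric σ N ε v * J + (neuralMetric σ N ε v * J)ᵀ +
        Matrix.of fun i j => fderiv ℝ (fun y => neuralMetric σ N ε y i j) v g) :=
  have h := IMM_contains (metricBounds_contains hσ.monotone N ε hv) hJ
  (h.add h.transpose).add (lieBounds_contains hσ N ε hv hg)

theorem jac_closedLoop {f : (Fin n → ℝ) → Fin n → ℝ} {x : Fin n → ℝ} (hf : DifferentiableAt ℝ f x)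
    (B : Matrix (Fin n) (Fin m) ℝ) {σ : ℝ → ℝ} (hσ : Differentiable ℝ σ) (u : FFNN (Fin m) n) :
    jac (closedLoop f B (u.eval σ)) x = jac f x + B * u.jacMat σ x := by
  have e : closedLoop f B (u.eval σ) = fun x => f x + (u.elide B).eval σ x := by
    ext1 x
    rw [FFNN.eval_elide, closedLoop]
  rw [e, ← FFNN.jacMat_elide, ← FFNN.jac_eval hσ, jac, jac, jac,
    fderiv_fun_add hf ((u.elide B).hasFDerivAt_eval hσ x).differentiableAt]
  simp

theorem contractionMatrix_isSymm {M : (Fin n → ℝ) → Matrix (Fin n) (Fin n) ℝ}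
    (hM : ∀ x, (M x).IsSymm) (F : (Fin n → ℝ) → Fin n → ℝ) (x : Fin n → ℝ) :
    (contractionMatrix M F x).IsSymm := by
  have h : (lieDeriv M F x)ᵀ = lieDeriv M F x := by
    ext i j
    simp only [lieDeriv, Matrix.transpose_apply, Matrix.of_apply, fun y => (hM y).apply i j]
  rw [Matrix.IsSymm, contractionMatrix, Matrix.transpose_add, Matrix.transpose_add, h,
    Matrix.transpose_mul, Matrix.transpose_mul, Matrix.transpose_transpose, (hM x).eq,
    add_comm (_ * _)]

/-- The contraction matrix is additive in the vector field, so the components of `f` and `B u` may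
be bounded separately. Symmetry of the metric turns `Jᵀ M` into `(M J)ᵀ`, which is the form bounded.
-/
theorem contractionBounds_contains {f : (Fin n → ℝ) → Fin n → ℝ} {x : Fin n → ℝ}
    (hf : DifferentiableAt ℝ f x) (B : Matrix (Fin n) (Fin m) ℝ) {σu σN : ℝ → ℝ}
    (hσu : AdmissibleActivation σu) (hσN : AdmissibleActivation σN) (u : FFNN (Fin m) n)
    (N : FFNN (Fin n × Fin n) n) (ε : ℝ) (r : InputRule) {X fB : IVec (Fin n)}
    {JfB : IMat (Fin n) (Fin n)} (hx : X.Contains x) (hfB : fB.Contains (f x))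
    (hJfB : JfB.Contains (jac f x)) :
    (contractionBounds r σu σN B u N ε X fB JfB).Contains
      (contractionMatrix (neuralMetric σN N ε) (closedLoop f B (u.eval σu)) x) := by
  have h := (componentBounds_contains hσN N ε hx hfB hJfB).add
    (componentBounds_contains hσN N ε hx (inputBounds_contains hσu.monotone r B u hx)
      (inputJacBounds_contains hσu r B u hx))
  suffices e : _ = _ from (congrArg _ e).mpr h
  rw [contractionMatrix, jac_closedLoop hf B hσu.differentiable, Matrix.transpose_mul,
    Matrix.transpose_mul, (neuralMetric_isSymm σN N ε x).eq]
  have e : lieDeriv (neuralMetric σN N ε) (closedLoop f B (u.eval σu)) x =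
      (Matrix.of fun i j => fderiv ℝ (fun y => neuralMetric σN N ε y i j) x (f x)) +
      Matrix.of fun i j => fderiv ℝ (fun y => neuralMetric σN N ε y i j) x (B *ᵥ u.eval σu x) := by
    ext i j
    simp [lieDeriv, closedLoop]
  rw [e, Matrix.transpose_add, mul_add, add_mul]
  abel

/-! The majorant -/

theorem posSemidef_neg_of_lambdaMax_nonpos {A : Matrix (Fin n) (Fin n) ℝ} (hA : A.IsSymm)
    (h : lambdaMax A ≤ 0) : (-A).PosSemidef := by
  have hH : A.IsHermitian := by rwa [Matrix.IsHermitian, Matrix.conjTranspose_eq_transpose_of_trivial]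
  rw [hH.neg.posSemidef_iff_eigenvalues_nonneg]
  intro i
  have hi := hH.neg.eigenvalues_mem_spectrum_real i
  rw [← spectrum.neg_eq, Set.mem_neg] at hi
  -- Finiteness of the spectrum makes the supremum a genuine upper bound, not the default value of
  -- an unbounded set.
  have := le_csSup (Matrix.finite_real_spectrum (A := A)).bddAbove hi
  simpa using this.trans h

/-- The form of `A` at `x` is compared with that of `G` at `|x|`. On the diagonal the factor `x i *
x i` is nonnegative, so an upper bound without absolute value suffices. -/
theorem posSemidef_neg_of_abs_le {A G : Matrix (Fin n) (Fin n) ℝ} (hA : A.IsSymm)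
    (hdiag : ∀ i, A i i ≤ G i i) (hoff : ∀ i j, i ≠ j → |A i j| ≤ G i j)
    (hG : (-G).PosSemidef) : (-A).PosSemidef := by
  refine .of_dotProduct_mulVec_nonneg ?_ fun x => ?_
  · rw [Matrix.IsHermitian, Matrix.conjTranspose_eq_transpose_of_trivial, Matrix.transpose_neg, hA.eq]
  have h := hG.dotProduct_mulVec_nonneg fun i => |x i|
  simp only [star_trivial, Matrix.neg_mulVec, dotProduct_neg, Left.nonneg_neg_iff] at h ⊢
  refine le_trans ?_ h
  simp only [dotProduct, Matrix.mulVec, Finset.mul_sum]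
  refine Finset.sum_le_sum fun i _ => Finset.sum_le_sum fun j _ => ?_
  by_cases hij : i = j
  · subst hij
    have := mul_le_mul_of_nonneg_right (hdiag i) (mul_self_nonneg (x i))
    calc x i * (A i i * x i) = A i i * (x i * x i) := by ring
      _ ≤ G i i * (x i * x i) := this
      _ = |x i| * (G i i * |x i|) := by rw [← abs_mul_abs_self (x i)]; ring
  · calc x i * (A i j * x j) ≤ |x i * (A i j * x j)| := le_abs_self _
      _ = |x i| * (|A i j| * |x j|) := by rw [abs_mul, abs_mul]
      _ ≤ |x i| * (G i j * |x j|) := by gcongr; exact hoff i j hij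

theorem componentBounds_isSymm (σ : ℝ → ℝ) (N : FFNN (Fin n × Fin n) n) (ε : ℝ)
    (X gB : IVec (Fin n)) (JB : IMat (Fin n) (Fin n)) :
    (componentBounds σ N ε X gB JB).lo.IsSymm ∧ (componentBounds σ N ε X gB JB).hi.IsSymm := by
  have h : ∀ i j, gradMetricBounds σ N X i j = gradMetricBounds σ N X j i := fun i j => by
    simp only [gradMetricBounds, IMat.add, add_comm]
  constructor <;> ext i j <;>
    simp only [componentBounds, IMat.add, IMat.transpose, lieBounds, Matrix.transpose_apply,
      Matrix.add_apply, Matrix.of_apply, h i j] <;> ring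

/-- Needed because the spectrum controls the quadratic form only for a symmetric matrix. -/
theorem majorant_contractionBounds_isSymm (r : InputRule) (σu σN : ℝ → ℝ)
    (B : Matrix (Fin n) (Fin m) ℝ) (u : FFNN (Fin m) n) (N : FFNN (Fin n × Fin n) n) (ε : ℝ)
    (X fB : IVec (Fin n)) (JfB : IMat (Fin n) (Fin n)) :
    (majorant (contractionBounds r σu σN B u N ε X fB JfB)).IsSymm := by
  ext i j
  obtain ⟨h1, h2⟩ := componentBounds_isSymm σN N ε X fB JfB
  obtain ⟨h3, h4⟩ := componentBounds_isSymm σN N ε X (inputBounds r σu B u X)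
    (inputJacBounds r σu B u X)
  by_cases hij : i = j
  · subst hij; rfl
  · simp only [majorant, contractionBounds, IMat.add, Matrix.transpose_apply, Matrix.of_apply,
      Matrix.add_apply, if_neg hij, if_neg (Ne.symm hij), h1.apply i j, h2.apply i j, h3.apply i j,
      h4.apply i j]

theorem posSemidef_neg_of_majorant {a : IMat (Fin n) (Fin n)} {A : Matrix (Fin n) (Fin n) ℝ}
    (hA : A.IsSymm) (ha : a.Contains A) (hG : (-majorant a).PosSemidef) : (-A).PosSemidef := by
  refine posSemidef_neg_of_abs_le hA (fun i => ?_) (fun i j hij => ?_) hG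
  · simpa [majorant] using (ha i i).2
  · simp only [majorant, Matrix.of_apply, if_neg hij]
    exact abs_le.2 ⟨by linarith [le_max_right (a.hi i j) (-a.lo i j), (ha i j).1],
      (ha i j).2.trans (le_max_left _ _)⟩

end

/-! ### From the matrix inequality to contraction of distances -/

section

open Set

variable {n : ℕ}

/-! Quadratic forms -/

theorem abs_dotProduct_mulVec_le (A : Matrix (Fin n) (Fin n) ℝ) (v w : Fin n → ℝ) :
    |v ⬝ᵥ (A *ᵥ w)| ≤ (∑ i, ∑ j, |A i j|) * (‖v‖ * ‖w‖) := by
  simp only [dotProduct, Matrix.mulVec, Finset.mul_sum, Finset.sum_mul]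
  refine (Finset.abs_sum_le_sum_abs _ _).trans (Finset.sum_le_sum fun i _ =>
    (Finset.abs_sum_le_sum_abs _ _).trans (Finset.sum_le_sum fun j _ => ?_))
  rw [abs_mul, abs_mul]
  calc |v i| * (|A i j| * |w j|) = |A i j| * (|v i| * |w j|) := by ring
    _ ≤ |A i j| * (‖v‖ * ‖w‖) := by
      gcongr
      exacts [norm_le_pi_norm v i, norm_le_pi_norm w j]

/-- The norm on `Fin n → ℝ` is the maximum norm, hence an inequality only. -/
theorem norm_mul_norm_le_dotProduct (v : Fin n → ℝ) : ‖v‖ * ‖v‖ ≤ v ⬝ᵥ v := by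
  have h0 : 0 ≤ v ⬝ᵥ v := Finset.sum_nonneg fun i _ => mul_self_nonneg _
  have h : ‖v‖ ≤ √(v ⬝ᵥ v) := by
    refine (pi_norm_le_iff_of_nonneg (Real.sqrt_nonneg _)).2 fun i => ?_
    refine Real.le_sqrt_of_sq_le ?_
    rw [Real.norm_eq_abs, sq_abs, sq]
    exact Finset.single_le_sum (f := fun i => v i * v i) (fun i _ => mul_self_nonneg _)
      (Finset.mem_univ i)
  exact (mul_self_le_mul_self (norm_nonneg _) h).trans_eq (Real.mul_self_sqrt h0)

/-- The length of the tangent vector `v` in the quadratic form `A`. -/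
def metricNorm (A : Matrix (Fin n) (Fin n) ℝ) (v : Fin n → ℝ) : ℝ := √(v ⬝ᵥ (A *ᵥ v))

theorem metricNorm_smul (A : Matrix (Fin n) (Fin n) ℝ) {a : ℝ} (ha : 0 ≤ a) (v : Fin n → ℝ) :
    metricNorm A (a • v) = a * metricNorm A v := by
  rw [metricNorm, metricNorm, Matrix.mulVec_smul, dotProduct_smul, smul_dotProduct, smul_smul,
    smul_eq_mul, Real.sqrt_mul (mul_self_nonneg a), Real.sqrt_mul_self ha]

open scoped MatrixOrder Matrix.Norms.L2Operator in
-- Writing `A = Cᵀ C` gives `vᵀAv = |Cv|²`. This makes the norm inequality for integrals available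
-- for a constant metric.
theorem exists_metricNorm_eq_norm {A : Matrix (Fin n) (Fin n) ℝ} (hA : A.PosSemidef) :
    ∃ L : (Fin n → ℝ) →L[ℝ] EuclideanSpace ℝ (Fin n), ∀ v, metricNorm A v = ‖L v‖ := by
  classical
  obtain ⟨C, rfl⟩ := CStarAlgebra.nonneg_iff_eq_star_mul_self.1 hA.nonneg
  refine ⟨LinearMap.toContinuousLinearMap
    ((WithLp.linearEquiv 2 ℝ (Fin n → ℝ)).symm.toLinearMap ∘ₗ C.mulVecLin), fun v => ?_⟩
  rw [Matrix.star_eq_conjTranspose, metricNorm, EuclideanSpace.norm_eq, ← Matrix.mulVec_mulVec, Matrix.dotProduct_mulVec,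
    Matrix.conjTranspose_eq_transpose_of_trivial, Matrix.vecMul_transpose]
  simp [dotProduct, sq]

theorem metricNorm_integral_le {A : Matrix (Fin n) (Fin n) ℝ} (hA : A.PosSemidef)
    {γ γ' : ℝ → Fin n → ℝ} {a b : ℝ} (hab : a ≤ b) (hc : ContinuousOn γ' (Icc a b))
    (hd : ∀ s ∈ Icc a b, HasDerivWithinAt γ (γ' s) (Icc a b) s) :
    metricNorm A (γ b - γ a) ≤ ∫ s in a..b, metricNorm A (γ' s) := by
  obtain ⟨L, hL⟩ := exists_metricNorm_eq_norm hA
  simp only [hL]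
  have e : ∫ s in a..b, L (γ' s) = L (γ b) - L (γ a) := by
    refine intervalIntegral.integral_eq_sub_of_hasDerivAt_of_le hab
      (fun s hs => (L.continuous.continuousAt.comp_continuousWithinAt (hd s hs).continuousWithinAt))
      (fun s hs => L.hasFDerivAt.comp_hasDerivAt s
        ((hd s (Ioo_subset_Icc_self hs)).hasDerivAt (Icc_mem_nhds hs.1 hs.2))) ?_
    exact (L.continuous.comp_continuousOn (by rwa [uIcc_of_le hab])).intervalIntegrable
  rw [map_sub, ← e]
  exact intervalIntegral.norm_integral_le_integral_norm hab

/-! The metric on a compact set -/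

theorem exists_sum_abs_sub_le {M : (Fin n → ℝ) → Matrix (Fin n) (Fin n) ℝ}
    (hM : ∀ i j, Continuous fun x => M x i j) {S : Set (Fin n → ℝ)} (hS : IsCompact S) {η : ℝ}
    (hη : 0 < η) :
    ∃ δ > 0, ∀ p ∈ S, ∀ q ∈ S, dist p q < δ → ∑ i, ∑ j, |(M p - M q) i j| ≤ η := by
  have hc : Continuous fun x => (fun i j => M x i j : Fin n → Fin n → ℝ) :=
    continuous_pi fun i => continuous_pi fun j => hM i j
  have hu := Metric.uniformContinuousOn_iff.1
    (hS.uniformContinuousOn_of_continuous hc.continuousOn)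
  -- There are `n * n` entries to sum; the added `1` avoids division by zero when `n = 0`.
  obtain ⟨δ, hδ, h⟩ := hu (η / (n * n + 1)) (by positivity)
  refine ⟨δ, hδ, fun p hp q hq hpq => ?_⟩
  have h1 : ∀ i j, |(M p - M q) i j| ≤ η / (n * n + 1) := fun i j =>
    (dist_le_pi_dist (fun j => M p i j) (fun j => M q i j) j).trans
      ((dist_le_pi_dist (fun i j => M p i j) (fun i j => M q i j) i).trans (h p hp q hq hpq).le)
  refine (Finset.sum_le_sum fun i _ => Finset.sum_le_sum fun j _ => h1 i j).trans ?_
  simp only [Finset.sum_const, Finset.card_univ, Fintype.card_fin, nsmul_eq_mul]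
  rw [← mul_assoc, mul_div_assoc', div_le_iff₀ (by positivity)]
  nlinarith

theorem exists_sum_abs_le {M : (Fin n → ℝ) → Matrix (Fin n) (Fin n) ℝ}
    (hM : ∀ i j, Continuous fun x => M x i j) {S : Set (Fin n → ℝ)} (hS : IsCompact S) :
    ∃ K > 0, ∀ x ∈ S, ∑ i, ∑ j, |M x i j| ≤ K := by
  have hc : Continuous fun x => ∑ i, ∑ j, |M x i j| :=
    continuous_finsetSum _ fun i _ => continuous_finsetSum _ fun j _ => (hM i j).abs
  obtain ⟨K, hK⟩ := hS.bddAbove_image hc.continuousOn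
  exact ⟨max K 1, by positivity, fun x hx => (hK (mem_image_of_mem _ hx)).trans (le_max_left _ _)⟩

variable {F : (Fin n → ℝ) → Fin n → ℝ} {M : (Fin n → ℝ) → Matrix (Fin n) (Fin n) ℝ} {c : ℝ}
  {S : Set (Fin n → ℝ)}

theorem IsContractionMetricOn.exists_lower_bound (h : IsContractionMetricOn F M c S) :
    ∃ a > 0, ∀ x ∈ S, ∀ v, a * (v ⬝ᵥ v) ≤ v ⬝ᵥ (M x *ᵥ v) := by
  obtain ⟨a, _, ha, _, hb⟩ := h.bounds
  refine ⟨a, ha, fun x hx v => ?_⟩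
  simpa [Matrix.sub_mulVec, Matrix.smul_mulVec] using (hb x hx).1.dotProduct_mulVec_nonneg v

theorem IsContractionMetricOn.posSemidef (h : IsContractionMetricOn F M c S) {x : Fin n → ℝ}
    (hx : x ∈ S) : (M x).PosSemidef := by
  obtain ⟨a, _, ha, _, hb⟩ := h.bounds
  simpa using (hb x hx).1.add (Matrix.PosSemidef.one.smul ha.le)

/-- Uniform continuity makes the change of the form at most `η * a * |v|²`, and the lower bound `a`
turns this into a relative error `η`. -/
theorem IsContractionMetricOn.exists_metricNorm_le (h : IsContractionMetricOn F M c S)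
    (hS : IsCompact S) {η : ℝ} (hη : 0 < η) :
    ∃ δ > 0, ∀ p ∈ S, ∀ q ∈ S, dist p q < δ → ∀ v,
      metricNorm (M p) v ≤ (1 + η) * metricNorm (M q) v := by
  obtain ⟨a, ha, hlow⟩ := h.exists_lower_bound
  obtain ⟨δ, hδ, hd⟩ := exists_sum_abs_sub_le (fun i j => (h.contDiff i j).continuous) hS
    (mul_pos hη ha)
  refine ⟨δ, hδ, fun p hp q hq hpq v => ?_⟩
  have hq0 : 0 ≤ v ⬝ᵥ (M q *ᵥ v) := by simpa using (h.posSemidef hq).dotProduct_mulVec_nonneg v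
  have h1 : v ⬝ᵥ (M p *ᵥ v) - v ⬝ᵥ (M q *ᵥ v) ≤ η * (v ⬝ᵥ (M q *ᵥ v)) := by
    rw [← dotProduct_sub, ← Matrix.sub_mulVec]
    calc v ⬝ᵥ ((M p - M q) *ᵥ v) ≤ _ := le_abs_self _
      _ ≤ _ := abs_dotProduct_mulVec_le _ _ _
      _ ≤ η * a * (v ⬝ᵥ v) := mul_le_mul (hd p hp q hq hpq) (norm_mul_norm_le_dotProduct v)
        (by positivity) (by positivity)
      _ = η * (a * (v ⬝ᵥ v)) := by ring
      _ ≤ _ := by gcongr; exact hlow q hq v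
  rw [metricNorm, metricNorm, ← Real.sqrt_sq (by positivity : 0 ≤ 1 + η),
    ← Real.sqrt_mul (by positivity)]
  exact Real.sqrt_le_sqrt (by nlinarith [mul_nonneg hη.le hq0, mul_nonneg (sq_nonneg η) hq0])

/-! Solutions that start close to each other -/

/-- Mean value inequality on the convex set `S ∩ ball p δ`, where `fderiv ℝ F` varies by less than
`ρ`. -/
theorem exists_linearization_le (hF : ContDiff ℝ 1 F) (hS : IsCompact S) (hconv : Convex ℝ S)
    {ρ : ℝ} (hρ : 0 < ρ) :
    ∃ δ > 0, ∀ p ∈ S, ∀ q ∈ S, dist p q < δ →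
      ‖F q - F p - jac F p *ᵥ (q - p)‖ ≤ ρ * ‖q - p‖ := by
  have hu := Metric.uniformContinuousOn_iff.1
    (hS.uniformContinuousOn_of_continuous (hF.continuous_fderiv (by norm_num)).continuousOn)
  obtain ⟨δ, hδ, h⟩ := hu ρ hρ
  refine ⟨δ, hδ, fun p hp q hq hpq => ?_⟩
  have hj : jac F p *ᵥ (q - p) = fderiv ℝ F p (q - p) :=
    LinearMap.toMatrix'_mulVec _ _
  rw [hj]
  refine (hconv.inter (convex_ball p δ)).norm_image_sub_le_of_norm_fderiv_le'
    (𝕜 := ℝ) (fun x _ => hF.differentiable (by norm_num) x) (fun x hx => ?_)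
    ⟨hp, Metric.mem_ball_self hδ⟩ ⟨hq, by rwa [Metric.mem_ball, dist_comm]⟩
  rw [← dist_eq_norm]
  exact (h x hx.1 p hp hx.2).le

theorem IsSolutionOn.continuousOn {T : ℝ} {x : ℝ → Fin n → ℝ} (hx : IsSolutionOn F T x) :
    ContinuousOn x (Icc 0 T) :=
  fun t ht => (hx t ht).continuousWithinAt

theorem IsSolutionOn.dist_le {T : ℝ} {x y : ℝ → Fin n → ℝ} {K : NNReal}
    (hF : LipschitzOnWith K F S) (hx : IsSolutionOn F T x) (hy : IsSolutionOn F T y)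
    (hxS : MapsTo x (Icc 0 T) S) (hyS : MapsTo y (Icc 0 T) S) :
    ∀ t ∈ Icc 0 T, dist (x t) (y t) ≤ dist (x 0) (y 0) * Real.exp (K * t) := by
  have right : ∀ {x}, IsSolutionOn F T x → ∀ t ∈ Ico 0 T,
      HasDerivWithinAt x (F (x t)) (Ici t) t := fun hx t ht =>
    (hx t (Ico_subset_Icc_self ht)).mono_of_mem_nhdsWithin
      (Filter.mem_of_superset (Icc_mem_nhdsGE ht.2) (Icc_subset_Icc_left ht.1))
  simpa using dist_le_of_trajectories_ODE_of_mem (v := fun _ => F) (s := fun _ => S)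
    (fun _ _ => hF) hx.continuousOn (right hx) (fun t ht => hxS (Ico_subset_Icc_self ht))
    hy.continuousOn (right hy) (fun t ht => hyS (Ico_subset_Icc_self ht)) le_rfl

theorem IsSolutionOn.eq_of_eq_zero {T : ℝ} {x y : ℝ → Fin n → ℝ} (hF : ContDiff ℝ 1 F)
    (hx : IsSolutionOn F T x) (hy : IsSolutionOn F T y) (h0 : x 0 = y 0) :
    ∀ t ∈ Icc 0 T, x t = y t := by
  -- The solutions need not stay in `S`, so the Lipschitz constant comes from a ball containing both
  -- trajectories.
  have hc : IsCompact (x '' Icc 0 T ∪ y '' Icc 0 T) :=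
    (isCompact_Icc.image_of_continuousOn hx.continuousOn).union
      (isCompact_Icc.image_of_continuousOn hy.continuousOn)
  obtain ⟨R, hR⟩ := hc.isBounded.subset_closedBall 0
  obtain ⟨K, hK⟩ := hF.contDiffOn.exists_lipschitzOnWith (by norm_num)
    (convex_closedBall (0 : Fin n → ℝ) R) (isCompact_closedBall 0 R)
  intro t ht
  have := hx.dist_le hK hy (fun s hs => hR (.inl (mem_image_of_mem _ hs)))
    (fun s hs => hR (.inr (mem_image_of_mem _ hs))) t ht
  rw [h0, dist_self, zero_mul] at this
  exact dist_le_zero.1 this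

/-- The second term vanishes if `w` solves the variational equation; for a difference of two
solutions it measures the linearization error. -/
theorem hasDerivWithinAt_quadraticForm (hM : ∀ i j, ContDiff ℝ 1 fun x => M x i j)
    (hsymm : ∀ x, (M x).IsSymm) {T t : ℝ} {x w : ℝ → Fin n → ℝ} {w' : Fin n → ℝ}
    (hx : HasDerivWithinAt x (F (x t)) (Icc 0 T) t) (hw : HasDerivWithinAt w w' (Icc 0 T) t) :
    HasDerivWithinAt (fun t => w t ⬝ᵥ (M (x t) *ᵥ w t))
      (w t ⬝ᵥ (contractionMatrix M F (x t) *ᵥ w t) +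
        2 * (w t ⬝ᵥ (M (x t) *ᵥ (w' - jac F (x t) *ᵥ w t)))) (Icc 0 T) t := by
  have hMx : ∀ i j, HasDerivWithinAt (fun t => M (x t) i j) (lieDeriv M F (x t) i j)
      (Icc 0 T) t := fun i j =>
    ((hM i j).differentiable (by norm_num) (x t)).hasFDerivAt.comp_hasDerivWithinAt t hx
  have hwi := hasDerivWithinAt_pi.1 hw
  have h : HasDerivWithinAt (fun t => ∑ i, w t i * ∑ j, M (x t) i j * w t j)
      (∑ i, (w' i * ∑ j, M (x t) i j * w t j +
        w t i * ∑ j, (lieDeriv M F (x t) i j * w t j + M (x t) i j * w' j))) (Icc 0 T) t :=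
    HasDerivWithinAt.fun_sum fun i _ => (hwi i).mul
      (HasDerivWithinAt.fun_sum fun j _ => (hMx i j).mul (hwi j))
  refine h.congr_deriv ?_
  have e : ∑ i, (w' i * ∑ j, M (x t) i j * w t j +
        w t i * ∑ j, (lieDeriv M F (x t) i j * w t j + M (x t) i j * w' j)) =
      w' ⬝ᵥ (M (x t) *ᵥ w t) + (w t ⬝ᵥ (lieDeriv M F (x t) *ᵥ w t) + w t ⬝ᵥ (M (x t) *ᵥ w')) := by
    simp only [dotProduct, Matrix.mulVec, Finset.sum_add_distrib, mul_add]
  have swap : ∀ v u : Fin n → ℝ, v ⬝ᵥ (M (x t) *ᵥ u) = u ⬝ᵥ (M (x t) *ᵥ v) := fun v u => by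
    rw [Matrix.dotProduct_mulVec, ← Matrix.mulVec_transpose, (hsymm (x t)).eq, dotProduct_comm]
  have hJ : w t ⬝ᵥ ((jac F (x t))ᵀ *ᵥ (M (x t) *ᵥ w t)) =
      w t ⬝ᵥ (M (x t) *ᵥ (jac F (x t) *ᵥ w t)) := by
    rw [Matrix.dotProduct_mulVec, Matrix.vecMul_transpose, swap]
  rw [e, contractionMatrix, Matrix.add_mulVec, Matrix.add_mulVec, ← Matrix.mulVec_mulVec,
    ← Matrix.mulVec_mulVec, Matrix.mulVec_sub, dotProduct_add, dotProduct_add, dotProduct_sub, hJ,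
    swap w' (w t)]
  ring

theorem IsContractionMetricOn.exists_metricNorm_sub_le (h : IsContractionMetricOn F M c S)
    (hF : ContDiff ℝ 1 F) (hS : IsCompact S) (hconv : Convex ℝ S) {T : ℝ} (hT : 0 ≤ T) {η : ℝ}
    (hη : 0 < η) :
    ∃ δ > 0, ∀ x y : ℝ → Fin n → ℝ, IsSolutionOn F T x → IsSolutionOn F T y →
      MapsTo x (Icc 0 T) S → MapsTo y (Icc 0 T) S → dist (x 0) (y 0) < δ →
      metricNorm (M (x T)) (y T - x T) ≤
        Real.exp ((-c + η) * T) * metricNorm (M (x 0)) (y 0 - x 0) := by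
  obtain ⟨a, ha, hlow⟩ := h.exists_lower_bound
  obtain ⟨K, hK, hKb⟩ := exists_sum_abs_le (fun i j => (h.contDiff i j).continuous) hS
  obtain ⟨Λ, hΛ⟩ := hF.contDiffOn.exists_lipschitzOnWith (by norm_num) hconv hS
  -- With this `ρ` the error term is at most `K * ρ * ‖w‖² = η * a * ‖w‖² ≤ η * E`.
  obtain ⟨δ, hδ, hlin⟩ := exists_linearization_le hF hS hconv (ρ := η * a / K) (by positivity)
  -- Solutions separate by at most the factor `exp (Λ * T)`, so they remain within `δ` on `[0, T]`.
  refine ⟨δ * Real.exp (-(Λ * T)), by positivity, fun x y hx hy hxS hyS h0 => ?_⟩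
  have hclose : ∀ t ∈ Icc 0 T, dist (x t) (y t) < δ := fun t ht => by
    calc dist (x t) (y t) ≤ dist (x 0) (y 0) * Real.exp (Λ * t) :=
          hx.dist_le hΛ hy hxS hyS t ht
      _ ≤ dist (x 0) (y 0) * Real.exp (Λ * T) := by gcongr; exact ht.2
      _ < δ * Real.exp (-(Λ * T)) * Real.exp (Λ * T) := by gcongr
      _ = δ := by rw [mul_assoc, ← Real.exp_add, neg_add_cancel, Real.exp_zero, mul_one]
  set E : ℝ → ℝ := fun t => (y t - x t) ⬝ᵥ (M (x t) *ᵥ (y t - x t)) with hE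
  set E' : ℝ → ℝ := fun t => (y t - x t) ⬝ᵥ (contractionMatrix M F (x t) *ᵥ (y t - x t)) +
    2 * ((y t - x t) ⬝ᵥ (M (x t) *ᵥ (F (y t) - F (x t) - jac F (x t) *ᵥ (y t - x t)))) with hE'
  have hder : ∀ t ∈ Icc 0 T, HasDerivWithinAt E (E' t) (Icc 0 T) t := fun t ht =>
    hasDerivWithinAt_quadraticForm h.contDiff h.symm (hx t ht) ((hy t ht).sub (hx t ht))
  have hbound : ∀ t ∈ Icc 0 T, E' t ≤ 2 * (-c + η) * E t := fun t ht => by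
    have h1 := (h.inequality (x t) (hxS ht)).dotProduct_mulVec_nonneg (y t - x t)
    simp only [star_trivial, Matrix.sub_mulVec, Matrix.smul_mulVec, dotProduct_sub,
      dotProduct_smul, smul_eq_mul] at h1
    set w := y t - x t with hw
    have h2 : w ⬝ᵥ (M (x t) *ᵥ (F (y t) - F (x t) - jac F (x t) *ᵥ w)) ≤ η * E t := by
      calc _ ≤ |w ⬝ᵥ (M (x t) *ᵥ (F (y t) - F (x t) - jac F (x t) *ᵥ w))| := le_abs_self _
        _ ≤ _ := abs_dotProduct_mulVec_le _ _ _
        _ ≤ K * (‖w‖ * (η * a / K * ‖w‖)) := by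
          gcongr
          · exact hKb _ (hxS ht)
          · exact hlin _ (hxS ht) _ (hyS ht) (hclose t ht)
        _ = η * (a * (‖w‖ * ‖w‖)) := by field_simp
        _ ≤ η * (a * (w ⬝ᵥ w)) := by gcongr; exact norm_mul_norm_le_dotProduct w
        _ ≤ η * E t := by gcongr; exact hlow _ (hxS ht) _
    have h1' : w ⬝ᵥ (contractionMatrix M F (x t) *ᵥ w) ≤ -2 * c * E t := sub_nonneg.1 h1
    calc E' t ≤ -2 * c * E t + 2 * (η * E t) := by simp only [hE']; gcongr
      _ = _ := by ring
  -- Integrating factor for `E' ≤ 2 * (-c + η) * E`.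
  have hanti : AntitoneOn (fun t => E t * Real.exp (-(2 * (-c + η) * t))) (Icc 0 T) := by
    have hd : ∀ t ∈ Icc 0 T, HasDerivWithinAt (fun t => E t * Real.exp (-(2 * (-c + η) * t)))
        ((E' t - 2 * (-c + η) * E t) * Real.exp (-(2 * (-c + η) * t))) (Icc 0 T) t := by
      intro t ht
      have he : HasDerivAt (fun t => Real.exp (-(2 * (-c + η) * t)))
          (Real.exp (-(2 * (-c + η) * t)) * -(2 * (-c + η) * 1)) t :=
        ((hasDerivAt_id t).const_mul _).neg.exp
      exact ((hder t ht).mul he.hasDerivWithinAt).congr_deriv (by ring)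
    refine antitoneOn_of_hasDerivWithinAt_nonpos (convex_Icc 0 T)
      (fun t ht => (hd t ht).continuousWithinAt)
      (fun t ht => (hd t (interior_subset ht)).mono interior_subset) fun t ht => ?_
    exact mul_nonpos_of_nonpos_of_nonneg (sub_nonpos.2 (hbound t (interior_subset ht)))
      (Real.exp_pos _).le
  have hfin := hanti (left_mem_Icc.2 hT) (right_mem_Icc.2 hT) hT
  simp only [mul_zero, neg_zero, Real.exp_zero, mul_one] at hfin
  have hfin' : E T ≤ Real.exp ((-c + η) * T) ^ 2 * E 0 := by
    have e : Real.exp ((-c + η) * T) ^ 2 * Real.exp (-(2 * (-c + η) * T)) = 1 := by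
      rw [← Real.exp_nat_mul, ← Real.exp_add, Real.exp_eq_one_iff]
      push_cast
      ring
    calc E T = Real.exp ((-c + η) * T) ^ 2 * (E T * Real.exp (-(2 * (-c + η) * T))) := by
          rw [mul_left_comm, e, mul_one]
      _ ≤ _ := by gcongr
  rw [metricNorm, metricNorm, ← Real.sqrt_sq (Real.exp_pos ((-c + η) * T)).le,
    ← Real.sqrt_mul (by positivity)]
  exact Real.sqrt_le_sqrt hfin'

/-! Lengths of curves -/

theorem continuousOn_metricNorm {M : (Fin n → ℝ) → Matrix (Fin n) (Fin n) ℝ}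
    (hM : ∀ i j, Continuous fun x => M x i j) {s : Set ℝ} {γ γ' : ℝ → Fin n → ℝ}
    (hγ : ContinuousOn γ s) (hγ' : ContinuousOn γ' s) :
    ContinuousOn (fun t => metricNorm (M (γ t)) (γ' t)) s := by
  have hi := continuousOn_pi.1 hγ'
  have h : ContinuousOn (fun t => ∑ i, γ' t i * ∑ j, M (γ t) i j * γ' t j) s :=
    continuousOn_finsetSum _ fun i _ => (hi i).fun_mul
      (continuousOn_finsetSum _ fun j _ => ((hM i j).comp_continuousOn' hγ).fun_mul (hi j))
  exact h.sqrt

theorem deriv_smoothTransition_of_nonpos {x : ℝ} (hx : x ≤ 0) :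
    deriv Real.smoothTransition x = 0 :=
  IsLocalMin.deriv_eq_zero (.of_forall fun y => by
    rw [Real.smoothTransition.zero_of_nonpos hx]; exact Real.smoothTransition.nonneg y)

theorem deriv_smoothTransition_of_one_le {x : ℝ} (hx : 1 ≤ x) :
    deriv Real.smoothTransition x = 0 :=
  IsLocalMax.deriv_eq_zero (.of_forall fun y => by
    rw [Real.smoothTransition.one_of_one_le hx]; exact Real.smoothTransition.le_one y)

/-- A smooth parametrization by `[0, 1]` of the polygon with vertices `p 0, …, p k`. It comes to
rest at each vertex. -/
def smoothPolygon (p : ℕ → Fin n → ℝ) (k : ℕ) (s : ℝ) : Fin n → ℝ :=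
  p 0 + ∑ i ∈ Finset.range k, Real.smoothTransition (k * s - i) • (p (i + 1) - p i)

/-- On the `j`-th subinterval the earlier transitions have reached `1` and telescope to `p j - p 0`;
the later ones are still `0`. -/
theorem smoothPolygon_eq (p : ℕ → Fin n → ℝ) {k j : ℕ} (hj : j < k) {s : ℝ} (h1 : j ≤ k * s)
    (h2 : k * s ≤ j + 1) :
    smoothPolygon p k s = p j + Real.smoothTransition (k * s - j) • (p (j + 1) - p j) := by
  have h : ∑ i ∈ Finset.range k, Real.smoothTransition (k * s - i) • (p (i + 1) - p i) =
      ∑ i ∈ Finset.range (j + 1), Real.smoothTransition (k * s - i) • (p (i + 1) - p i) := by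
    refine (Finset.sum_subset (Finset.range_mono hj) fun i _ hi => ?_).symm
    have : (j : ℝ) + 1 ≤ i := by exact_mod_cast not_lt.1 (fun h => hi (Finset.mem_range.2 h))
    rw [Real.smoothTransition.zero_of_nonpos (by linarith), zero_smul]
  have h' : ∑ i ∈ Finset.range j, Real.smoothTransition (k * s - i) • (p (i + 1) - p i) =
      ∑ i ∈ Finset.range j, (p (i + 1) - p i) := by
    refine Finset.sum_congr rfl fun i hi => ?_
    have : (i : ℝ) + 1 ≤ j := by exact_mod_cast Finset.mem_range.1 hi
    rw [Real.smoothTransition.one_of_one_le (by linarith), one_smul]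
  rw [smoothPolygon, h, Finset.sum_range_succ, h', Finset.sum_range_sub]
  abel

theorem exists_mul_mem_Icc {k : ℕ} (hk : 0 < k) {s : ℝ} (hs : s ∈ Icc (0 : ℝ) 1) :
    ∃ j < k, (j : ℝ) ≤ k * s ∧ k * s ≤ j + 1 := by
  have hk' : (0 : ℝ) < k := by exact_mod_cast hk
  rcases hs.2.lt_or_eq with h | rfl
  · have h0 : 0 ≤ k * s := mul_nonneg hk'.le hs.1
    exact ⟨⌊k * s⌋₊, (Nat.floor_lt h0).2 (by nlinarith), Nat.floor_le h0,
      (Nat.lt_floor_add_one _).le⟩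
  -- At `s = 1` the floor would be `k`; the last subinterval is used instead.
  · obtain ⟨l, rfl⟩ := Nat.exists_eq_succ_of_ne_zero hk.ne'
    exact ⟨l, Nat.lt_succ_self l, by simp, by simp⟩

theorem hasDerivAt_smoothTransition_comp (k i s : ℝ) :
    HasDerivAt (fun s => Real.smoothTransition (k * s - i))
      (deriv Real.smoothTransition (k * s - i) * k) s := by
  have h := ((Real.smoothTransition.contDiff (n := 1)).differentiable (by norm_num)
    (k * s - i)).hasDerivAt
  have h' : HasDerivAt (fun s => k * s - i) k s := by
    simpa using ((hasDerivAt_id s).const_mul k).sub_const i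
  exact h.comp s h'

/-- The distance admits only `C¹` curves, so the corners are passed at zero speed. The speed profile
of each edge integrates to `1`, so the edge contributes at most `c i`. -/
theorem geodesicDist_le_of_polygon {M : (Fin n → ℝ) → Matrix (Fin n) (Fin n) ℝ}
    (hM : ∀ i j, Continuous fun x => M x i j) {S : Set (Fin n → ℝ)} (hS : Convex ℝ S)
    (p : ℕ → Fin n → ℝ) {k : ℕ} (hk : 0 < k) (hp : ∀ i ≤ k, p i ∈ S) (c : ℕ → ℝ)
    (hc : ∀ i < k, ∀ q ∈ segment ℝ (p i) (p (i + 1)), metricNorm (M q) (p (i + 1) - p i) ≤ c i) :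
    geodesicDist M S (p 0) (p k) ≤ ENNReal.ofReal (∑ i ∈ Finset.range k, c i) := by
  have hk1 : (1 : ℝ) ≤ k := by exact_mod_cast hk
  have hsmooth : ContDiff ℝ 1 (smoothPolygon p k) :=
    contDiff_const.add (ContDiff.sum fun i _ => ((Real.smoothTransition.contDiff (n := 1)).comp
      ((contDiff_const.mul contDiff_id).sub contDiff_const)).smul contDiff_const)
  have hseg : ∀ {j : ℕ} {s : ℝ}, j < k → (j : ℝ) ≤ k * s → k * s ≤ j + 1 →
      smoothPolygon p k s ∈ segment ℝ (p j) (p (j + 1)) := fun hj h1 h2 => by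
    rw [smoothPolygon_eq p hj h1 h2, segment_eq_image']
    exact ⟨_, ⟨Real.smoothTransition.nonneg _, Real.smoothTransition.le_one _⟩, rfl⟩
  have hcurve : IsCurveIn S (p 0) (p k) (smoothPolygon p k) := by
    refine ⟨hsmooth.contDiffOn, fun s hs => ?_, ?_, ?_⟩
    · obtain ⟨j, hj, h1, h2⟩ := exists_mul_mem_Icc hk hs
      exact hS.segment_subset (hp j hj.le) (hp (j + 1) hj) (hseg hj h1 h2)
    · rw [smoothPolygon_eq p hk (by simp) (by simp)]
      simp [Real.smoothTransition.zero]
    · obtain ⟨l, rfl⟩ := Nat.exists_eq_succ_of_ne_zero hk.ne'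
      rw [smoothPolygon_eq p (Nat.lt_succ_self l) (by simp) (by simp)]
      simp [Real.smoothTransition.one]
  refine (iInf₂_le _ hcurve).trans (ENNReal.ofReal_le_ofReal ?_)
  have hder : ∀ s, HasDerivAt (smoothPolygon p k) (∑ i ∈ Finset.range k,
      (deriv Real.smoothTransition (k * s - i) * k) • (p (i + 1) - p i)) s := fun s =>
    (HasDerivAt.fun_sum fun (i : ℕ) _ =>
      (hasDerivAt_smoothTransition_comp k i s).smul_const (p (i + 1) - p i)).const_add (p 0)
  have hcont : Continuous (deriv Real.smoothTransition) :=
    (Real.smoothTransition.contDiff (n := 1)).continuous_deriv (by norm_num)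
  have hspeed : ∀ s ∈ Icc (0 : ℝ) 1,
      metricNorm (M (smoothPolygon p k s)) (derivWithin (smoothPolygon p k) (Icc 0 1) s) ≤
        ∑ i ∈ Finset.range k, deriv Real.smoothTransition (k * s - i) * k * c i := by
    intro s hs
    obtain ⟨j, hj, h1, h2⟩ := exists_mul_mem_Icc hk hs
    have hzero : ∀ i ∈ Finset.range k, i ≠ j → deriv Real.smoothTransition (k * s - i) = 0 := by
      intro i _ hij
      rcases lt_or_gt_of_ne hij with h | h
      · have : (i : ℝ) + 1 ≤ j := by exact_mod_cast h
        exact deriv_smoothTransition_of_one_le (by linarith)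
      · have : (j : ℝ) + 1 ≤ i := by exact_mod_cast h
        exact deriv_smoothTransition_of_nonpos (by linarith)
    have hj' := Finset.mem_range.2 hj
    have hnn : 0 ≤ deriv Real.smoothTransition (k * s - j) * k :=
      mul_nonneg Real.smoothTransition.monotone.deriv_nonneg (by positivity)
    rw [(hder s).hasDerivWithinAt.derivWithin (uniqueDiffOn_Icc one_pos s hs),
      Finset.sum_eq_single_of_mem j hj' fun i hi hij => by rw [hzero i hi hij, zero_mul, zero_smul],
      Finset.sum_eq_single_of_mem j hj' fun i hi hij => by rw [hzero i hi hij, zero_mul, zero_mul],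
      metricNorm_smul _ hnn]
    exact mul_le_mul_of_nonneg_left (hc j hj _ (hseg hj h1 h2)) hnn
  have hint : ∀ i : ℕ, Continuous fun s : ℝ => deriv Real.smoothTransition (k * s - i) * k :=
    fun i => (hcont.comp (by fun_prop)).mul continuous_const
  have hone : ∀ i < k, ∫ s in (0 : ℝ)..1, deriv Real.smoothTransition (k * s - i) * k = 1 := by
    intro i hi
    have hi' : (i : ℝ) + 1 ≤ k := by exact_mod_cast hi
    rw [intervalIntegral.integral_eq_sub_of_hasDerivAt
      (fun s _ => hasDerivAt_smoothTransition_comp k i s) ((hint i).intervalIntegrable _ _),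
      Real.smoothTransition.one_of_one_le (by linarith),
      Real.smoothTransition.zero_of_nonpos (by simp), sub_zero]
  calc curveLength M (smoothPolygon p k)
      ≤ ∫ s in (0 : ℝ)..1,
          ∑ i ∈ Finset.range k, deriv Real.smoothTransition (k * s - i) * k * c i := by
        refine intervalIntegral.integral_mono_on zero_le_one ?_ ?_ hspeed
        · refine ContinuousOn.intervalIntegrable ?_
          rw [uIcc_of_le zero_le_one]
          exact continuousOn_metricNorm hM hsmooth.continuous.continuousOn
            (hsmooth.contDiffOn.continuousOn_derivWithin (uniqueDiffOn_Icc one_pos) le_rfl)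
        · exact (continuous_finsetSum _ fun i _ =>
            (hint i).mul continuous_const).intervalIntegrable _ _
    _ = ∑ i ∈ Finset.range k, c i := by
        rw [intervalIntegral.integral_finsetSum fun i _ =>
          ((hint i).fun_mul continuous_const).intervalIntegrable _ _]
        refine Finset.sum_congr rfl fun i hi => ?_
        rw [intervalIntegral.integral_mul_const, hone i (Finset.mem_range.1 hi), one_mul]

/-! Contraction of geodesic distances -/

/-- The chord of a short arc is, up to the factor `1 + η`, at most as long as the arc. -/
theorem metricNorm_chord_le (h : IsContractionMetricOn F M c S) {V : Set (Fin n → ℝ)} (hV : V ⊆ S)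
    {p q : Fin n → ℝ} {γ : ℝ → Fin n → ℝ} (hγ : IsCurveIn V p q γ) {η δ : ℝ}
    (hδ : ∀ p ∈ S, ∀ q ∈ S, dist p q < δ → ∀ v,
      metricNorm (M p) v ≤ (1 + η) * metricNorm (M q) v)
    {a b : ℝ} (ha : 0 ≤ a) (hab : a ≤ b) (hb : b ≤ 1)
    (hclose : ∀ s ∈ Icc a b, dist (γ a) (γ s) < δ) :
    metricNorm (M (γ a)) (γ b - γ a) ≤ (1 + η) *
      ∫ s in a..b, metricNorm (M (γ s)) (derivWithin γ (Icc 0 1) s) := by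
  have hsub : Icc a b ⊆ Icc 0 1 := Icc_subset_Icc ha hb
  have hcd : ContinuousOn (derivWithin γ (Icc 0 1)) (Icc a b) :=
    (hγ.contDiffOn.continuousOn_derivWithin (uniqueDiffOn_Icc one_pos) le_rfl).mono hsub
  have haI : a ∈ Icc (0 : ℝ) 1 := hsub (left_mem_Icc.2 hab)
  have h1 := metricNorm_integral_le (h.posSemidef (hV (hγ.mapsTo haI))) hab hcd fun s hs =>
    ((hγ.contDiffOn.differentiableOn (by norm_num) s (hsub hs)).hasDerivWithinAt).mono hsub
  refine h1.trans ?_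
  have hcM : ∀ i j, Continuous fun x => M x i j := fun i j => (h.contDiff i j).continuous
  rw [← intervalIntegral.integral_const_mul]
  refine intervalIntegral.integral_mono_on hab ?_ ?_ fun s hs =>
    hδ _ (hV (hγ.mapsTo haI)) _ (hV (hγ.mapsTo (hsub hs))) (hclose s hs) _
  · refine ContinuousOn.intervalIntegrable ?_
    rw [uIcc_of_le hab]
    exact continuousOn_metricNorm (γ := fun _ => γ a) hcM continuousOn_const hcd
  · refine ContinuousOn.intervalIntegrable ?_
    rw [uIcc_of_le hab]
    exact (continuousOn_metricNorm hcM (hγ.contDiffOn.continuousOn.mono hsub) hcd).const_mul _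

theorem IsContractionMetricOn.geodesicDist_le_mul_curveLength (h : IsContractionMetricOn F M c S)
    (hF : ContDiff ℝ 1 F) (hS : IsCompact S) (hconv : Convex ℝ S) {T : ℝ} (hT : 0 ≤ T)
    {V : Set (Fin n → ℝ)} (hV : V ⊆ S) {z : (Fin n → ℝ) → ℝ → Fin n → ℝ}
    (hz : ∀ p ∈ V, IsSolutionOn F T (z p) ∧ z p 0 = p ∧ MapsTo (z p) (Icc 0 T) S)
    {p q : Fin n → ℝ} {γ : ℝ → Fin n → ℝ} (hγ : IsCurveIn V p q γ) {η : ℝ} (hη : 0 < η) :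
    geodesicDist M S (z p T) (z q T) ≤
      ENNReal.ofReal ((1 + η) ^ 2 * Real.exp ((-c + η) * T) * curveLength M γ) := by
  obtain ⟨δ₁, hδ₁, hcmp⟩ := h.exists_metricNorm_le hS hη
  obtain ⟨δ₂, hδ₂, hflow⟩ := h.exists_metricNorm_sub_le hF hS hconv hT hη
  obtain ⟨Λ, hΛ⟩ := hF.contDiffOn.exists_lipschitzOnWith (by norm_num) hconv hS
  have huc := Metric.uniformContinuousOn_iff.1
    (isCompact_Icc.uniformContinuousOn_of_continuous hγ.contDiffOn.continuousOn)
  -- The first bound keeps the images at time `T` within `δ₁`; the second compares the metric along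
  -- an arc; the third permits the contraction of chords.
  obtain ⟨δ, hδ, hγδ⟩ := huc (min (δ₁ * Real.exp (-(Λ * T))) (min δ₁ δ₂)) (by positivity)
  obtain ⟨k', hk'⟩ := exists_nat_one_div_lt hδ
  set k := k' + 1 with hk
  have hk0 : (0 : ℝ) < k := by positivity
  have hkδ : 1 / (k : ℝ) < δ := by rw [hk]; exact_mod_cast hk'
  set s : ℕ → ℝ := fun i => i / k with hs
  have hsI : ∀ i ≤ k, s i ∈ Icc (0 : ℝ) 1 := fun i hi =>
    ⟨by positivity, (div_le_one hk0).2 (by exact_mod_cast hi)⟩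
  have hstep : ∀ i, s (i + 1) = s i + 1 / k := fun i => by
    simp only [hs]; push_cast; ring
  have hmono : ∀ i, s i ≤ s (i + 1) := fun i => by rw [hstep]; linarith [one_div_pos.2 hk0]
  have hdist : ∀ i < k, ∀ t ∈ Icc (s i) (s (i + 1)), dist (γ (s i)) (γ t) <
      min (δ₁ * Real.exp (-(Λ * T))) (min δ₁ δ₂) := fun i hi t ht => by
    refine hγδ _ (hsI i hi.le) _ ⟨(hsI i hi.le).1.trans ht.1, ht.2.trans (hsI (i + 1) hi).2⟩ ?_
    rw [dist_comm, Real.dist_eq, abs_of_nonneg (sub_nonneg.2 ht.1)]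
    have := ht.2
    rw [hstep] at this
    linarith
  have hγV : ∀ i ≤ k, γ (s i) ∈ V := fun i hi => hγ.mapsTo (hsI i hi)
  have hend : ∀ i ≤ k, z (γ (s i)) T ∈ S := fun i hi =>
    (hz _ (hγV i hi)).2.2 (right_mem_Icc.2 hT)
  set ℓ : ℕ → ℝ := fun i =>
    ∫ t in s i..s (i + 1), metricNorm (M (γ t)) (derivWithin γ (Icc 0 1) t) with hℓ
  have hpoly := geodesicDist_le_of_polygon (fun i j => (h.contDiff i j).continuous) hconv
    (fun i => z (γ (s i)) T) (k := k) (Nat.succ_pos _) hend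
    (fun i => (1 + η) ^ 2 * Real.exp ((-c + η) * T) * ℓ i) fun i hi r hr => by
      obtain ⟨hz1, hz10, hz1S⟩ := hz _ (hγV i hi.le)
      obtain ⟨hz2, hz20, hz2S⟩ := hz _ (hγV (i + 1) hi)
      have hd := hdist i hi _ (right_mem_Icc.2 (hmono i))
      have hdT : dist (z (γ (s (i + 1))) T) (z (γ (s i)) T) < δ₁ := by
        calc _ ≤ dist (γ (s (i + 1))) (γ (s i)) * Real.exp (Λ * T) := by
              simpa only [hz10, hz20] using
                hz2.dist_le hΛ hz1 hz2S hz1S T (right_mem_Icc.2 hT)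
          _ < δ₁ * Real.exp (-(Λ * T)) * Real.exp (Λ * T) := by
              rw [dist_comm]
              gcongr
              exact hd.trans_le (min_le_left _ _)
          _ = δ₁ := by rw [mul_assoc, ← Real.exp_add, neg_add_cancel, Real.exp_zero, mul_one]
      have hr' : dist r (z (γ (s i)) T) < δ₁ := by
        have := (convex_ball (z (γ (s i)) T) δ₁).segment_subset (Metric.mem_ball_self hδ₁)
          (Metric.mem_ball.2 hdT) hr
        exact this
      have h1 := hcmp r (hconv.segment_subset (hend i hi.le) (hend (i + 1) hi) hr) _
        (hend i hi.le) hr' (z (γ (s (i + 1))) T - z (γ (s i)) T)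
      have h2 := hflow _ _ hz1 hz2 hz1S hz2S (by
        rw [hz10, hz20]
        exact hd.trans_le ((min_le_right _ _).trans (min_le_right _ _)))
      rw [hz10, hz20] at h2
      have h3 := metricNorm_chord_le h hV hγ hcmp (hsI i hi.le).1 (hmono i) (hsI (i + 1) hi).2
        fun t ht => (hdist i hi t ht).trans_le ((min_le_right _ _).trans (min_le_left _ _))
      -- One factor `1 + η` freezes the metric along the image segment, the other passes from the
      -- initial chord to its arc.
      calc _ ≤ _ := h1
        _ ≤ (1 + η) * (Real.exp ((-c + η) * T) * ((1 + η) * ℓ i)) := by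
          gcongr
          exact h2.trans (by gcongr)
        _ = _ := by ring
  have hs0 : s 0 = 0 := by simp [hs]
  have hsk : s k = 1 := div_self hk0.ne'
  have hsum : ∑ i ∈ Finset.range k, ℓ i = curveLength M γ := by
    have := intervalIntegral.sum_integral_adjacent_intervals (μ := MeasureTheory.volume)
      (f := fun t => metricNorm (M (γ t)) (derivWithin γ (Icc 0 1) t)) (a := s) (n := k)
      fun i hi => ContinuousOn.intervalIntegrable (by
        rw [uIcc_of_le (hmono i)]
        exact (continuousOn_metricNorm (fun i j => (h.contDiff i j).continuous)
          hγ.contDiffOn.continuousOn (hγ.contDiffOn.continuousOn_derivWithin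
            (uniqueDiffOn_Icc one_pos) le_rfl)).mono
              (Icc_subset_Icc (hsI i hi.le).1 (hsI (i + 1) hi).2))
    rw [hs0, hsk] at this
    exact this
  rw [← Finset.mul_sum, hsum] at hpoly
  simpa only [hs0, hsk, hγ.source, hγ.target] using hpoly

theorem IsContractionMetricOn.isContractingOn (h : IsContractionMetricOn F M c S)
    (hF : ContDiff ℝ 1 F) (hS : IsCompact S) (hconv : Convex ℝ S) :
    IsContractingOn F M c S := by
  intro T hT V hV hsol x y hx hy hx0 hy0
  choose! z hz hz0 hzS using hsol
  have hxT : x T = z (x 0) T :=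
    -- Only some solution from each point of `V` is known to stay in `S`; uniqueness identifies it
    -- with the given one.
    hx.eq_of_eq_zero hF (hz _ hx0) (hz0 _ hx0).symm T (right_mem_Icc.2 hT)
  have hyT : y T = z (y 0) T :=
    hy.eq_of_eq_zero hF (hz _ hy0) (hz0 _ hy0).symm T (right_mem_Icc.2 hT)
  rw [hxT, hyT]
  have hexp : ENNReal.ofReal (Real.exp (-c * T)) ≠ 0 := by simp [Real.exp_pos]
  -- The factor is moved to the left so that the infimum over curves stands alone; the case of no
  -- curve is included.
  rw [mul_comm, ← ENNReal.div_le_iff hexp ENNReal.ofReal_ne_top]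
  refine le_iInf₂ fun γ hγ => ?_
  rw [ENNReal.div_le_iff hexp ENNReal.ofReal_ne_top, mul_comm,
    ← ENNReal.ofReal_mul (Real.exp_pos _).le]
  have hlim : Filter.Tendsto (fun η : ℝ =>
      ENNReal.ofReal ((1 + η) ^ 2 * Real.exp ((-c + η) * T) * curveLength M γ))
      (nhdsWithin 0 (Ioi 0)) (nhds (ENNReal.ofReal (Real.exp (-c * T) * curveLength M γ))) := by
    have hc : Continuous fun η : ℝ =>
        ENNReal.ofReal ((1 + η) ^ 2 * Real.exp ((-c + η) * T) * curveLength M γ) :=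
      ENNReal.continuous_ofReal.comp (by fun_prop)
    simpa using (hc.tendsto 0).mono_left nhdsWithin_le_nhds
  refine ge_of_tendsto hlim (Filter.eventually_of_mem self_mem_nhdsWithin fun η hη => ?_)
  exact h.geodesicDist_le_mul_curveLength hF hS hconv hT hV
    (fun p hp => ⟨hz p hp, hz0 p hp, hzS p hp⟩) hγ hη

/-! Uniform bounds on the neural metric -/

/-- Compactness supplies the upper constant; the lower one is `ε`, as `NᵀN` is positive
semidefinite. -/
theorem exists_smul_one_sub_posSemidef (hM : ∀ i j, Continuous fun x => M x i j)
    (hsymm : ∀ x, (M x).IsSymm) (hS : IsCompact S) :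
    ∃ a : ℝ, 0 < a ∧ ∀ x ∈ S, (a • (1 : Matrix (Fin n) (Fin n) ℝ) - M x).PosSemidef := by
  obtain ⟨K, hK, hb⟩ := exists_sum_abs_le hM hS
  refine ⟨K, hK, fun x hx => .of_dotProduct_mulVec_nonneg ?_ fun v => ?_⟩
  · rw [Matrix.IsHermitian, Matrix.conjTranspose_eq_transpose_of_trivial, Matrix.transpose_sub,
      (hsymm x).eq, Matrix.transpose_smul, Matrix.transpose_one]
  · simp only [star_trivial, Matrix.sub_mulVec, Matrix.smul_mulVec, Matrix.one_mulVec,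
      dotProduct_sub, dotProduct_smul, smul_eq_mul, sub_nonneg]
    calc v ⬝ᵥ (M x *ᵥ v) ≤ _ := le_abs_self _
      _ ≤ _ := abs_dotProduct_mulVec_le _ _ _
      _ ≤ K * (v ⬝ᵥ v) := mul_le_mul (hb x hx) (norm_mul_norm_le_dotProduct v) (by positivity) hK.le

theorem neuralMetric_sub_posSemidef (σ : ℝ → ℝ) (N : FFNN (Fin n × Fin n) n) (ε : ℝ)
    (x : Fin n → ℝ) :
    (neuralMetric σ N ε x - ε • (1 : Matrix (Fin n) (Fin n) ℝ)).PosSemidef := by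
  rw [neuralMetric, add_sub_cancel_right, ← Matrix.conjTranspose_eq_transpose_of_trivial]
  exact Matrix.posSemidef_conjTranspose_mul_self _

end

end NeuralContraction

end

open NeuralContraction in
theorem corollary1 {n m : ℕ}
    (f : (Fin n → ℝ) → Fin n → ℝ) (hf : ContDiff ℝ 1 f)
    (B : Matrix (Fin n) (Fin m) ℝ)
    (σu σN : ℝ → ℝ) (hσu : AdmissibleActivation σu) (hσN : AdmissibleActivation σN)
    (u : FFNN (Fin m) n) (N : FFNN (Fin n × Fin n) n)
    (ε : ℝ) (hε : 0 < ε)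
    (xlo xhi : Fin n → ℝ) (hx : xlo ≤ xhi)
    (fB : IVec (Fin n)) (hfB : ∀ x ∈ Set.Icc xlo xhi, fB.Contains (f x))
    (JfB : IMat (Fin n) (Fin n)) (hJfB : ∀ x ∈ Set.Icc xlo xhi, JfB.Contains (jac f x))
    (r : InputRule)
    (hG : lambdaMax (majorant (contractionBounds r σu σN B u N ε ⟨xlo, xhi⟩ fB JfB)) ≤ 0) :
    (∀ x ∈ Set.Icc xlo xhi,
      (-contractionMatrix (neuralMetric σN N ε) (closedLoop f B (u.eval σu)) x).PosSemidef) ∧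
    IsContractionMetricOn (closedLoop f B (u.eval σu)) (neuralMetric σN N ε) 0
      (Set.Icc xlo xhi) ∧
    IsContractingOn (closedLoop f B (u.eval σu)) (neuralMetric σN N ε) 0
      (Set.Icc xlo xhi) := by
  have hneg : ∀ x ∈ Set.Icc xlo xhi,
      (-contractionMatrix (neuralMetric σN N ε) (closedLoop f B (u.eval σu)) x).PosSemidef :=
    fun x hxI => posSemidef_neg_of_majorant
      (contractionMatrix_isSymm (neuralMetric_isSymm σN N ε) _ x)
      (contractionBounds_contains (X := ⟨xlo, xhi⟩) (hf.differentiable (by norm_num) x) B hσu hσN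
        u N ε r (fun i => ⟨hxI.1 i, hxI.2 i⟩) (hfB x hxI) (hJfB x hxI))
      (posSemidef_neg_of_lambdaMax_nonpos (majorant_contractionBounds_isSymm ..) hG)
  have hM : ∀ i j, ContDiff ℝ 1 fun x => neuralMetric σN N ε x i j :=
    contDiff_neuralMetric (hσN.contDiff.of_le (by norm_num)) N ε
  obtain ⟨a, ha, hupper⟩ := exists_smul_one_sub_posSemidef (fun i j => (hM i j).continuous)
    (neuralMetric_isSymm σN N ε) (isCompact_Icc (a := xlo) (b := xhi))
  have hmetric : IsContractionMetricOn (closedLoop f B (u.eval σu)) (neuralMetric σN N ε) 0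
      (Set.Icc xlo xhi) :=
    { contDiff := hM
      symm := neuralMetric_isSymm σN N ε
      bounds := ⟨ε, a, hε, ha, fun x hxI =>
        ⟨neuralMetric_sub_posSemidef σN N ε x, hupper x hxI⟩⟩
      inequality := fun x hxI => by simpa using hneg x hxI }
  have hF : ContDiff ℝ 1 (closedLoop f B (u.eval σu)) :=
    hf.add ((LinearMap.toContinuousLinearMap B.mulVecLin).contDiff.comp
      (u.contDiff_eval (hσu.contDiff.of_le (by norm_num))))
  exact ⟨hneg, hmetric, hmetric.isContractingOn hF isCompact_Icc (convex_Icc xlo xhi)⟩
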